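/- **Theorem.** Let $f:\mathbb{R}^m\times\mathbb{R}^n\to\mathbb{R}$ be $\ell$-smooth ($f$ is differentiable and $\|\nabla f(z)-\nabla f(z')\|\le \ell\|z-z'\|$ for all $z,z'$, Euclidean norms), let $\mathcal{Y}\subseteq\mathbb{R}^n$ be closed, convex and bounded with diameter $D>0$, and suppose that $f(\cdot,\mathbf y)$ is $L$-Lipschitz for each $\mathbf y\in\mathcal Y$ and $f(\mathbf x,\cdot)$ is concave on $\mathcal Y$ for each $\mathbf x$, where $\ell,L>0$. Put $\Phi(\mathbf x)=\max_{\mathbf y\in\mathcal Y}f(\mathbf x,\mathbf y)$ and assume that $\Phi$ is bounded below. Let $\Phi_{1/2\ell}(\mathbf x)=\min_{\mathbf w}\{\Phi(\mathbf w)+\ell\|\mathbf w-\mathbf x\|^2\}$ be its Moreau envelope. Let $\epsilon>0$, $\mathbf x_0\in\mathbb{R}^m$, $\mathbf y_0\in\mathcal Y$, $\Delta_\Phi=\Phi(\mathbf x_0)-\inf_{\mathbf x}\Phi(\mathbf x)$ and $\Delta_0=\Phi(\mathbf x_0)-f(\mathbf x_0,\mathbf y_0)$. Then $\Phi$ is $\ell$-weakly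 convex (i.e. $\Phi+\frac{\ell}{2}\|\cdot\|^2$ is convex), $\Phi_{1/2\ell}$ is differentiable, and the following statements hold with a constant $C>0$ that is absolute (independent of $f,\mathcal Y,m,n$ and of all parameters). A point $\mathbf x$ is called $\epsilon$-stationary if $\|\nabla\Phi_{1/2\ell}(\mathbf x)\|\le\epsilon$, and a random point $\hat{\mathbf x}$ is called $\epsilon$-stationary in mean square if $\mathbb{E}\|\nabla\Phi_{1/2\ell}(\hat{\mathbf x})\|^2\le\epsilon^2$. $\mathcal P_{\mathcal Y}$ denotes the orthogonal projection onto $\mathcal Y$. 1. (TTGDA) Let $\mathbf x_{t}=\mathbf x_{t-1}-\eta_{\mathbf x}\nabla_{\mathbf x}f(\mathbf x_{t-1},\mathbf y_{t-1})$ and $\mathbf y_{t}=\mathcal P_{\mathcal Y}(\mathbf y_{t-1}+\eta_{\mathbf y}\nabla_{\mathbf y}f(\mathbf x_{t-1},\mathbf y_{t-1}))$ with $$\eta_{\mathbf x}=\min\Big\{\tfrac{\epsilon^2}{80\ell L^2},\tfrac{\epsilon^4}{4096\ell^3L^2D^2}\Big\},\qquad \eta_{\mathbf y}=\tfrac1\ell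 .$$ There is an $N$ such that the first $N$ iterations use at most $$C\Big(\tfrac{\ell L^2\Delta_\Phi}{\epsilon^4}+\tfrac{\ell\Delta_0}{\epsilon^2}\Big)\max\Big\{1,\tfrac{\ell^2D^2}{\epsilon^2}\Big\}$$ gradient evaluations (one per iteration) and, for every $T\ge N$, the returned point $\hat{\mathbf x}$, drawn uniformly at random from $\{\mathbf x_0,\dots,\mathbf x_T\}$, is $\epsilon$-stationary in mean square; moreover some $\mathbf x_t$ with $t\le T$ is $\epsilon$-stationary. 2. (TTSGDA, $M=1$) Let $\sigma\ge0$ and let $G(\mathbf x,\mathbf y,\xi)=(G_{\mathbf x},G_{\mathbf y})$ be a jointly measurable stochastic gradient with $\mathbb{E}[G(\mathbf x,\mathbf y,\xi)]=\nabla f(\mathbf x,\mathbf y)$ and $\mathbb{E}\|G(\mathbf x,\mathbf y,\xi)-\mathbb{E}[G(\mathbf x,\mathbf y,\xi)]\|^2\le\sigma^2$ for all $\mathbf x\in\mathbb{R}^m$, $\mathbf y\in\mathcal Y$. Run the iteration of part 1 with $\nabla f(\mathbf x_{t-1},\mathbf y_{t-1})$ replaced by $G(\mathbf x_{t-1},\mathbf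 y_{t-1},\xi^{t-1})$, where $\xi^0,\xi^1,\dots$ are i.i.d. copies of $\xi$, and with $$\eta_{\mathbf x}=\min\Big\{\tfrac{\epsilon^2}{80\ell(L^2+\sigma^2)},\tfrac{\epsilon^4}{8192\ell^3(L^2+\sigma^2)D^2},\tfrac{\epsilon^6}{131072\ell^3(L^2+\sigma^2)D^2\sigma^2}\Big\},\qquad \eta_{\mathbf y}=\min\Big\{\tfrac1{2\ell},\tfrac{\epsilon^2}{32\ell\sigma^2}\Big\}$$ (a term with $\sigma=0$ in the denominator is read as $+\infty$). There is an $N$ such that the first $N$ iterations use at most $$C\Big(\tfrac{\ell(L^2+\sigma^2)\Delta_\Phi}{\epsilon^4}+\tfrac{\ell\Delta_0}{\epsilon^2}\Big)\max\Big\{1,\tfrac{\ell^2D^2}{\epsilon^2},\tfrac{\ell^2D^2\sigma^2}{\epsilon^4}\Big\}$$ stochastic gradient evaluations (one per iteration) and, for every $T\ge N$, the returned point $\hat{\mathbf x}$, drawn uniformly at random from $\{\mathbf x_0,\dots,\mathbf x_T\}$ independently of the samples, is $\epsilon$-stationary in mean square, the expectation being over the samples and the draw. -/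

import Mathlib

open MeasureTheory ProbabilityTheory

noncomputable section

namespace TwoTimescale

/-- `ℝᵈ` with the Euclidean norm. -/
abbrev Vec (d : ℕ) : Type := EuclideanSpace ℝ (Fin d)

/-- `ℝᵐ × ℝⁿ` with the Euclidean norm `‖(x, y)‖² = ‖x‖² + ‖y‖²`. -/
abbrev VecPair (m n : ℕ) : Type := WithLp 2 (Vec m × Vec n)

/-- The pair `(x, y)` as a point of the Euclidean space `ℝᵐ × ℝⁿ`. -/
def mkPair {m n : ℕ} (x : Vec m) (y : Vec n) : VecPair m n := WithLp.toLp 2 (x, y)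

/-- `f` is `ℓ`-smooth: differentiable with `ℓ`-Lipschitz gradient. -/
def IsSmooth {E : Type*} [NormedAddCommGroup E] [InnerProductSpace ℝ E] [CompleteSpace E]
    (ℓ : ℝ) (f : E → ℝ) : Prop :=
  Differentiable ℝ f ∧ ∀ z z' : E, ‖gradient f z - gradient f z'‖ ≤ ℓ * ‖z - z'‖

/-- `φ` is `ρ`-weakly convex: `φ + (ρ/2)‖·‖²` is convex. -/
def IsWeaklyConvex {E : Type*} [NormedAddCommGroup E] [InnerProductSpace ℝ E]
    (ρ : ℝ) (φ : E → ℝ) : Prop :=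
  ConvexOn ℝ Set.univ fun x => φ x + ρ / 2 * ‖x‖ ^ 2

/-- The Moreau envelope `φ_lam(x) = min_w φ(w) + ‖w - x‖² / (2 lam)`. -/
def moreauEnvelope {E : Type*} [NormedAddCommGroup E] (φ : E → ℝ) (lam : ℝ) (x : E) : ℝ :=
  ⨅ w : E, φ w + 1 / (2 * lam) * ‖w - x‖ ^ 2

/-- `x` is an `ε`-stationary point of the `ρ`-weakly convex function `φ`:
`‖∇φ_{1/2ρ}(x)‖ ≤ ε`. -/
def IsStationary {E : Type*} [NormedAddCommGroup E] [InnerProductSpace ℝ E] [CompleteSpace E]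
    (φ : E → ℝ) (ρ ε : ℝ) (x : E) : Prop :=
  IsWeaklyConvex ρ φ ∧
    DifferentiableAt ℝ (moreauEnvelope φ (1 / (2 * ρ))) x ∧
    ‖gradient (moreauEnvelope φ (1 / (2 * ρ))) x‖ ≤ ε

/-- A random point `X` is an `ε`-stationary point (in mean square) of the `ρ`-weakly convex
function `φ`: `𝔼 ‖∇φ_{1/2ρ}(X)‖² ≤ ε²`. By Jensen's inequality this contains
`𝔼 ‖∇φ_{1/2ρ}(X)‖ ≤ ε`. -/
def IsStationaryInMeanSquare {E : Type*} [NormedAddCommGroup E] [InnerProductSpace ℝ E]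
    [CompleteSpace E] {Ω : Type*} [MeasurableSpace Ω] (P : Measure Ω)
    (φ : E → ℝ) (ρ ε : ℝ) (X : Ω → E) : Prop :=
  IsWeaklyConvex ρ φ ∧
    Differentiable ℝ (moreauEnvelope φ (1 / (2 * ρ))) ∧
    Integrable (fun ω => ‖gradient (moreauEnvelope φ (1 / (2 * ρ))) (X ω)‖ ^ 2) P ∧
    ∫ ω, ‖gradient (moreauEnvelope φ (1 / (2 * ρ))) (X ω)‖ ^ 2 ∂P ≤ ε ^ 2

/-- The objective as a function of the joint variable `(x, y)`. -/
def joint {m n : ℕ} (f : Vec m → Vec n → ℝ) : VecPair m n → ℝ := fun z => f z.fst z.snd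

/-- The gradient `∇f(x, y) = (∇ₓf(x, y), ∇_y f(x, y))`. -/
def grad {m n : ℕ} (f : Vec m → Vec n → ℝ) (x : Vec m) (y : Vec n) : VecPair m n :=
  gradient (joint f) (mkPair x y)

/-- `Φ(x) = max_{y ∈ Y} f(x, y)`. -/
def maxFun {m n : ℕ} (f : Vec m → Vec n → ℝ) (Y : Set (Vec n)) (x : Vec m) : ℝ :=
  ⨆ y : Y, f x y

/-- `Φ` is an attained maximum for continuous `f` and nonempty compact `Y`. -/
theorem maxFun_isGreatest {m n : ℕ} (f : Vec m → Vec n → ℝ) (Y : Set (Vec n)) (x : Vec m)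
    (hf : Continuous (f x)) (hY : IsCompact Y) (hne : Y.Nonempty) :
    IsGreatest (f x '' Y) (maxFun f Y x) := by
  have h := (hY.image hf).isGreatest_sSup (hne.image _)
  rwa [sSup_image'] at h

/-- `f` is `ℓ`-smooth, and, over the constraint set `Y`, `L`-Lipschitz in `x` and concave in `y`;
`Y` is closed, convex and bounded with diameter `D > 0`. -/
structure SmoothNonconvexConcave {m n : ℕ} (f : Vec m → Vec n → ℝ) (Y : Set (Vec n))
    (ℓ L D : ℝ) : Prop where
  ell_pos : 0 < ℓ
  L_pos : 0 < L
  D_pos : 0 < D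
  smooth : IsSmooth ℓ (joint f)
  lipschitz : ∀ y ∈ Y, ∀ x x' : Vec m, |f x y - f x' y| ≤ L * ‖x - x'‖
  concave : ∀ x, ConcaveOn ℝ Y (f x)
  convex : Convex ℝ Y
  closed : IsClosed Y
  bounded : Bornology.IsBounded Y
  diam : Metric.diam Y = D

/-- The orthogonal projection onto `Y`: a nearest point of `Y` (it exists and is unique if `Y` is
nonempty, closed and convex; the value is irrelevant if there is no nearest point). -/
def proj {d : ℕ} (Y : Set (Vec d)) (z : Vec d) : Vec d :=
  open Classical in
  if h : ∃ p ∈ Y, ∀ q ∈ Y, ‖z - p‖ ≤ ‖z - q‖ then h.choose else z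

theorem proj_spec {d : ℕ} (Y : Set (Vec d)) (hY : IsClosed Y) (hne : Y.Nonempty) (z : Vec d) :
    proj Y z ∈ Y ∧ ∀ q ∈ Y, ‖z - proj Y z‖ ≤ ‖z - q‖ := by
  have h : ∃ p ∈ Y, ∀ q ∈ Y, ‖z - p‖ ≤ ‖z - q‖ := by
    obtain ⟨p, hp, hd⟩ := hY.exists_infDist_eq_dist hne z
    refine ⟨p, hp, fun q hq => ?_⟩
    rw [← dist_eq_norm, ← dist_eq_norm, ← hd]
    exact Metric.infDist_le_dist_of_mem hq
  unfold proj
  rw [dif_pos h]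
  exact h.choose_spec

/-- A state of the algorithms: the current iterates and the number of (stochastic) gradient
evaluations made so far. -/
structure State (m n : ℕ) where
  x : Vec m
  y : Vec n
  evals : ℕ

/-- One iteration with (estimated) gradient `g`, obtained at the price of `cost` evaluations:
`x ← x - ηx g_x`, `y ← P_Y(y + ηy g_y)`. -/
def State.step {m n : ℕ} (Y : Set (Vec n)) (ηx ηy : ℝ) (g : VecPair m n) (cost : ℕ)
    (s : State m n) : State m n where
  x := s.x - ηx • g.fst
  y := proj Y (s.y + ηy • g.snd)
  evals := s.evals + cost

/-- The state of TTGDA after `t` iterations, started at `(x₀, y₀)`, with step sizes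
`ηx t`, `ηy t`; each iteration evaluates `∇f` once. -/
def ttgda {m n : ℕ} (f : Vec m → Vec n → ℝ) (Y : Set (Vec n)) (ηx ηy : ℕ → ℝ)
    (x₀ : Vec m) (y₀ : Vec n) : ℕ → State m n
  | 0 => ⟨x₀, y₀, 0⟩
  | t + 1 =>
    let s := ttgda f Y ηx ηy x₀ y₀ t
    s.step Y (ηx t) (ηy t) (grad f s.x s.y) 1

/-- The mini-batch gradient estimator `(1/M) ∑ᵢ G(x, y, ξᵢ)`. -/
def SG {m n M : ℕ} {Ξ : Type*} (G : Vec m → Vec n → Ξ → VecPair m n) (ξ : Fin M → Ξ)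
    (x : Vec m) (y : Vec n) : VecPair m n :=
  (1 / (M : ℝ)) • ∑ i, G x y (ξ i)

/-- The state of TTSGDA after `t` iterations when the samples drawn in iteration `t` are
`ξ t 1, …, ξ t M`; each iteration makes `M` stochastic gradient evaluations. -/
def ttsgda {m n M : ℕ} {Ξ : Type*} (G : Vec m → Vec n → Ξ → VecPair m n) (Y : Set (Vec n))
    (ηx ηy : ℕ → ℝ) (x₀ : Vec m) (y₀ : Vec n) (ξ : ℕ → Fin M → Ξ) : ℕ → State m n
  | 0 => ⟨x₀, y₀, 0⟩
  | t + 1 =>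
    let s := ttsgda G Y ηx ηy x₀ y₀ ξ t
    s.step Y (ηx t) (ηy t) (SG G (ξ t) s.x s.y) M

/-- `G` with sample law `ν` is a stochastic gradient oracle for `f` on `ℝᵐ × Y`:
unbiased, with variance at most `σ²`. -/
structure IsStochasticGradient {m n : ℕ} {Ξ : Type*} [MeasurableSpace Ξ]
    (f : Vec m → Vec n → ℝ) (Y : Set (Vec n)) (G : Vec m → Vec n → Ξ → VecPair m n)
    (ν : Measure Ξ) (σ : ℝ) : Prop where
  sigma_nonneg : 0 ≤ σ
  isProbabilityMeasure : IsProbabilityMeasure ν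
  measurable : Measurable fun p : Vec m × Vec n × Ξ => G p.1 p.2.1 p.2.2
  square_integrable : ∀ x, ∀ y ∈ Y, MemLp (G x y) 2 ν
  unbiased : ∀ x, ∀ y ∈ Y, ∫ s, G x y s ∂ν = grad f x y
  variance_le : ∀ x, ∀ y ∈ Y, ∫ s, ‖G x y s - ∫ s', G x y s' ∂ν‖ ^ 2 ∂ν ≤ σ ^ 2

/-- The samples `ξ t i` are independent with common law `ν`. -/
structure IsSampling {Ω Ξ : Type*} [MeasurableSpace Ω] [MeasurableSpace Ξ] {M : ℕ}
    (P : Measure Ω) (ν : Measure Ξ) (ξ : ℕ → Fin M → Ω → Ξ) : Prop where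
  measurable : ∀ t i, Measurable (ξ t i)
  law : ∀ t i, P.map (ξ t i) = ν
  indep : iIndepFun (fun p : ℕ × Fin M => ξ p.1 p.2) P

/-- The uniform distribution on the indices `0, …, T`, used to draw the returned iterate. -/
def uniformIndex (T : ℕ) : Measure (Fin (T + 1)) :=
  (PMF.uniformOfFintype (Fin (T + 1))).toMeasure

/-- Step size in `x` for TTGDA. -/
def etaX (ℓ L D ε : ℝ) : ℝ :=
  min (ε ^ 2 / (80 * ℓ * L ^ 2)) (ε ^ 4 / (4096 * ℓ ^ 3 * L ^ 2 * D ^ 2))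

/-- Step size in `x` for TTSGDA; for `σ = 0` the last term of the minimum is `+∞`. -/
def etaXStoch (ℓ L D σ ε : ℝ) : ℝ :=
  open Classical in
  if σ = 0 then
    min (ε ^ 2 / (80 * ℓ * (L ^ 2 + σ ^ 2)))
      (ε ^ 4 / (8192 * ℓ ^ 3 * (L ^ 2 + σ ^ 2) * D ^ 2))
  else
    min (ε ^ 2 / (80 * ℓ * (L ^ 2 + σ ^ 2)))
      (min (ε ^ 4 / (8192 * ℓ ^ 3 * (L ^ 2 + σ ^ 2) * D ^ 2))
        (ε ^ 6 / (131072 * ℓ ^ 3 * (L ^ 2 + σ ^ 2) * D ^ 2 * σ ^ 2)))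

/-- Step size in `y` for TTSGDA; for `σ = 0` the last term of the minimum is `+∞`. -/
def etaYStoch (ℓ σ ε : ℝ) : ℝ :=
  open Classical in
  if σ = 0 then 1 / (2 * ℓ) else min (1 / (2 * ℓ)) (ε ^ 2 / (32 * ℓ * σ ^ 2))

/-- `(ℓL²Δ_Φ/ε⁴ + ℓΔ₀/ε²) max{1, ℓ²D²/ε²}`. -/
def boundDet (ℓ L D ΔΦ Δ₀ ε : ℝ) : ℝ :=
  (ℓ * L ^ 2 * ΔΦ / ε ^ 4 + ℓ * Δ₀ / ε ^ 2) * max 1 (ℓ ^ 2 * D ^ 2 / ε ^ 2)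

/-- `(ℓ(L²+σ²)Δ_Φ/ε⁴ + ℓΔ₀/ε²) max{1, ℓ²D²/ε², ℓ²D²σ²/ε⁴}`. -/
def boundStoch (ℓ L D σ ΔΦ Δ₀ ε : ℝ) : ℝ :=
  (ℓ * (L ^ 2 + σ ^ 2) * ΔΦ / ε ^ 4 + ℓ * Δ₀ / ε ^ 2) *
    max 1 (max (ℓ ^ 2 * D ^ 2 / ε ^ 2) (ℓ ^ 2 * D ^ 2 * σ ^ 2 / ε ^ 4))

end TwoTimescale

end

/-! The Moreau envelope `Φ_{1/2ℓ}`, with prox map `p`, lies below the quadratic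
`w ↦ Φ(p x) + ℓ‖p x - w‖²`. Hence a step `x⁺ = x - ηx g` decreases it by `(ηx/2)‖∇Φ_{1/2ℓ}(x)‖²`,
up to `2ηxℓ(Φ(x) - f(x, y))` and terms of order `ηx²`. Summing, the mean of `‖∇Φ_{1/2ℓ}‖²` is
controlled by the mean of the gap `Φ(x) - f(x, y)`.

The gap is small because `y` follows a projected ascent whose steps are much longer than those
of `x`. On a block of `B` iterations `y` is compared with a near-maximizer `z` for the value of `x`
at the start of the block: the potential `f(x, y) - ‖z - y‖²/(2ηy)` telescopes, and the drift of `x`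
costs at most `Bηx(L² + σ²)`. The mean gap is thus of order
`D²/(ηyB) + Bηx(L² + σ²) + ηyσ²`, which `B ≈ 32ℓD²/(ηyε²)` makes of order `ε²/ℓ`. The blocks are
placed so that the first one may be short; it is compared with `y₀` instead of a near-maximizer, at
the price of `BΔ₀`. Exact gradients are the noise-free case on a one-point probability space. -/

noncomputable section

open scoped RealInnerProductSpace NNReal

namespace TwoTimescale

/-! ### Smooth and concave functions -/

theorem le_of_forall_le_add_mul {a b c : ℝ} (h : ∀ t : ℝ, 0 < t → t ≤ 1 → a ≤ b + t * c) :
    a ≤ b := by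
  have hlim : Filter.Tendsto (fun t => b + t * c) (nhdsWithin 0 (Set.Ioi 0)) (nhds b) :=
    (Continuous.tendsto' (by fun_prop) 0 b (by simp)).mono_left nhdsWithin_le_nhds
  refine ge_of_tendsto hlim ?_
  filter_upwards [Ioc_mem_nhdsGT one_pos] with t ht using h t ht.1 ht.2

section Smooth

variable {E : Type*} [NormedAddCommGroup E] [InnerProductSpace ℝ E]

theorem inner_sub_le_of_variational_inequality {y p z g : E} {η : ℝ} (hη : 0 < η)
    (hp : ⟪y + η • g - p, z - p⟫ ≤ 0) :
    ⟪g, z - p⟫ ≤ (‖z - y‖ ^ 2 - ‖z - p‖ ^ 2 - ‖p - y‖ ^ 2) / (2 * η) := by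
  have hpolar : ‖z - y‖ ^ 2 = ‖z - p‖ ^ 2 + 2 * ⟪p - y, z - p⟫ + ‖p - y‖ ^ 2 := by
    rw [← sub_add_sub_cancel z p y, norm_add_sq_real, real_inner_comm]
  have hexpand : ⟪y + η • g - p, z - p⟫ = η * ⟪g, z - p⟫ - ⟪p - y, z - p⟫ := by
    rw [show y + η • g - p = η • g - (p - y) by abel, inner_sub_left, real_inner_smul_left]
  rw [le_div_iff₀ (by positivity)]
  linarith

theorem inner_add_sq_le_of_step_size {e d : E} {ℓ η : ℝ} (hη : 0 < η)
    (hstep : η * ℓ ≤ 1 / 2 ∨ η * ℓ ≤ 1 ∧ e = 0) :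
    ⟪e, d⟫ + ℓ / 2 * ‖d‖ ^ 2 ≤ ‖d‖ ^ 2 / (2 * η) + η * ‖e‖ ^ 2 := by
  suffices 2 * η * ⟪e, d⟫ + η * ℓ * ‖d‖ ^ 2 ≤ ‖d‖ ^ 2 + 2 * (η * ‖e‖) ^ 2 by
    have hdiv := div_le_div_of_nonneg_right this (by positivity : 0 ≤ 2 * η)
    field_simp at hdiv ⊢
    linarith
  rcases hstep with hhalf | ⟨hone, rfl⟩
  · have hcs := mul_le_mul_of_nonneg_left (real_inner_le_norm e d) hη.le
    have hℓ := mul_le_mul_of_nonneg_right hhalf (sq_nonneg ‖d‖)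
    linarith [sq_nonneg (2 * (η * ‖e‖) - ‖d‖)]
  · have hℓ := mul_le_mul_of_nonneg_right hone (sq_nonneg ‖d‖)
    simpa using hℓ

variable [CompleteSpace E] {ℓ : ℝ} {F : E → ℝ}

theorem hasDerivAt_comp_add_smul {v : E} {z d : E} {t : ℝ} (hF : HasGradientAt F v (z + t • d)) :
    HasDerivAt (fun s : ℝ => F (z + s • d)) ⟪v, d⟫ t := by
  have hline : HasDerivAt (fun s : ℝ => z + s • d) d t := by
    simpa using ((hasDerivAt_id t).smul_const d).const_add z
  exact hF.hasFDerivAt.comp_hasDerivAt t hline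

theorem le_add_inner_of_concaveOn {Y : Set E} (hF : ConcaveOn ℝ Y F) {v y z : E}
    (hv : HasGradientAt F v y) (hy : y ∈ Y) (hz : z ∈ Y) : F z ≤ F y + ⟪v, z - y⟫ := by
  have hseg : Set.Icc (0 : ℝ) 1 ⊆ AffineMap.lineMap y z ⁻¹' Y := fun t ht =>
    hF.1.lineMap_mem hy hz ht
  have hconc : ConcaveOn ℝ (Set.Icc 0 1) (fun t : ℝ => F (y + t • (z - y))) := by
    simpa [Function.comp_def, AffineMap.lineMap_apply, add_comm] using
      (hF.comp_affineMap (AffineMap.lineMap y z)).subset hseg (convex_Icc 0 1)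
  have hderiv : HasDerivAt (fun t : ℝ => F (y + t • (z - y))) ⟪v, z - y⟫ 0 :=
    hasDerivAt_comp_add_smul (by simpa using hv)
  have hslope := hconc.slope_le_of_hasDerivAt (Set.left_mem_Icc.2 zero_le_one)
    (Set.right_mem_Icc.2 zero_le_one) one_pos hderiv
  simp only [slope_def_field, one_smul, add_sub_cancel, zero_smul, add_zero, sub_zero,
    div_one] at hslope
  linarith

theorem hasGradientAt_of_abs_sub_le_mul_sq {v z : E} (C : ℝ)
    (h : ∀ w, |F w - F z - ⟪v, w - z⟫| ≤ C * ‖w - z‖ ^ 2) : HasGradientAt F v z := by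
  rw [hasGradientAt_iff_isLittleO]
  have hO : (fun w => F w - F z - ⟪v, w - z⟫) =O[nhds z] fun w => ‖w - z‖ ^ 2 :=
    Asymptotics.IsBigO.of_bound C (.of_forall fun w => by simpa using h w)
  exact hO.trans_isLittleO <| (Asymptotics.isLittleO_norm_pow_id one_lt_two).comp_tendsto
    (tendsto_sub_nhds_zero_iff.2 Filter.tendsto_id)

theorem norm_le_of_hasGradientAt_of_lipschitzWith {K : ℝ≥0} (hF : LipschitzWith K F) {v z : E}
    (hv : HasGradientAt F v z) : ‖v‖ ≤ K := by
  simpa using hv.hasFDerivAt.le_of_lipschitz hF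

namespace IsSmooth

variable (hF : IsSmooth ℓ F)
include hF

theorem hasGradientAt (z : E) : HasGradientAt F (gradient F z) z :=
  (hF.1 z).hasGradientAt

theorem continuous : Continuous F :=
  hF.1.continuous

theorem continuous_gradient : Continuous (gradient F) :=
  (LipschitzWith.of_dist_le' fun z w => by simpa only [dist_eq_norm] using hF.2 z w).continuous

theorem inner_gradient_sub_le (z d : E) {t : ℝ} (ht : 0 ≤ t) :
    ⟪gradient F (z + t • d) - gradient F z, d⟫ ≤ ℓ * t * ‖d‖ ^ 2 :=
  calc ⟪gradient F (z + t • d) - gradient F z, d⟫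
      ≤ ‖gradient F (z + t • d) - gradient F z‖ * ‖d‖ := real_inner_le_norm _ _
    _ ≤ ℓ * ‖z + t • d - z‖ * ‖d‖ := by gcongr; exact hF.2 _ _
    _ = ℓ * t * ‖d‖ ^ 2 := by
      rw [add_sub_cancel_left, norm_smul, Real.norm_of_nonneg ht]
      ring

theorem le_quadratic (z w : E) :
    F w ≤ F z + ⟪gradient F z, w - z⟫ + ℓ / 2 * ‖w - z‖ ^ 2 := by
  set d := w - z with hd
  have hderiv (t : ℝ) : HasDerivAt (fun s : ℝ => F (z + s • d)) ⟪gradient F (z + t • d), d⟫ t :=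
    hasDerivAt_comp_add_smul (hF.hasGradientAt _)
  have hderiv' (t : ℝ) :
      HasDerivAt (fun s : ℝ => F z + s * ⟪gradient F z, d⟫ + ℓ / 2 * s ^ 2 * ‖d‖ ^ 2)
        (⟪gradient F z, d⟫ + ℓ * t * ‖d‖ ^ 2) t := by
    have hlin := ((hasDerivAt_id t).mul_const ⟪gradient F z, d⟫).const_add (F z)
    have hsq := ((hasDerivAt_pow 2 t).const_mul (ℓ / 2)).mul_const (‖d‖ ^ 2)
    exact (hlin.add hsq).congr_deriv (by push_cast; ring)
  have hle := image_le_of_deriv_right_le_deriv_boundary (a := (0 : ℝ)) (b := 1)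
    (fun t _ => (hderiv t).continuousAt.continuousWithinAt)
    (fun t _ => (hderiv t).hasDerivWithinAt) (by simp)
    (fun t _ => (hderiv' t).continuousAt.continuousWithinAt)
    (fun t _ => (hderiv' t).hasDerivWithinAt)
    (fun t ht => by
      have := hF.inner_gradient_sub_le z d ht.1
      rw [inner_sub_left] at this
      linarith)
    (Set.right_mem_Icc.2 zero_le_one)
  simpa [hd] using hle

theorem neg : IsSmooth ℓ (-F) := by
  have hgrad (z : E) : gradient (-F) z = -gradient F z := by simp [gradient, fderiv_neg]
  refine ⟨hF.1.neg, fun z z' => ?_⟩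
  rw [hgrad, hgrad, neg_sub_neg, norm_sub_rev]
  exact hF.2 z z'

theorem quadratic_le (z w : E) :
    F z + ⟪gradient F z, w - z⟫ - ℓ / 2 * ‖w - z‖ ^ 2 ≤ F w := by
  have hneg := hF.neg.le_quadratic z w
  have hgrad : gradient (-F) z = -gradient F z := by simp [gradient, fderiv_neg]
  rw [hgrad, inner_neg_left] at hneg
  simp only [Pi.neg_apply] at hneg
  linarith

end IsSmooth

theorem le_of_isSmooth_of_concaveOn (hF : IsSmooth ℓ F) {Y : Set E} (hconc : ConcaveOn ℝ Y F)
    {y z : E} (hy : y ∈ Y) (hz : z ∈ Y) (p : E) :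
    F z ≤ F p + ⟪gradient F y, z - p⟫ + ℓ / 2 * ‖p - y‖ ^ 2 := by
  have hconcave := le_add_inner_of_concaveOn hconc (hF.hasGradientAt y) hy hz
  have hsmooth := hF.quadratic_le y p
  have hsplit : ⟪gradient F y, z - y⟫ = ⟪gradient F y, z - p⟫ + ⟪gradient F y, p - y⟫ := by
    rw [← inner_add_right, sub_add_sub_cancel]
  linarith

theorem le_ascent_step (hF : IsSmooth ℓ F) {Y : Set E} (hconc : ConcaveOn ℝ Y F) {y z p g : E}
    (hy : y ∈ Y) (hz : z ∈ Y) {η : ℝ} (hη : 0 < η) (hp : ⟪y + η • g - p, z - p⟫ ≤ 0)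
    (hstep : η * ℓ ≤ 1 / 2 ∨ η * ℓ ≤ 1 ∧ g - gradient F y = 0) :
    F z ≤ F p + (‖z - y‖ ^ 2 - ‖z - p‖ ^ 2) / (2 * η) + η * ‖g - gradient F y‖ ^ 2 -
      ⟪g - gradient F y, z - y⟫ := by
  have hvalue := le_of_isSmooth_of_concaveOn hF hconc hy hz p
  have hdist := inner_sub_le_of_variational_inequality hη hp
  have hnoise := inner_add_sq_le_of_step_size (d := p - y) hη hstep
  have hsplit : ⟪gradient F y, z - p⟫ =
      ⟪g, z - p⟫ - ⟪g - gradient F y, z - y⟫ + ⟪g - gradient F y, p - y⟫ := by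
    simp only [inner_sub_left, inner_sub_right]
    ring
  have hdiv : (‖z - y‖ ^ 2 - ‖z - p‖ ^ 2 - ‖p - y‖ ^ 2) / (2 * η) =
      (‖z - y‖ ^ 2 - ‖z - p‖ ^ 2) / (2 * η) - ‖p - y‖ ^ 2 / (2 * η) := by ring
  linarith

end Smooth

/-! ### Projection onto a closed convex set -/

theorem le_of_sq_le_mul {a c : ℝ} (hc : 0 ≤ c) (h : a ^ 2 ≤ c * a) : a ≤ c := by
  by_contra! hlt
  nlinarith

section Projection

variable {d : ℕ} {Y : Set (Vec d)} (hY : IsClosed Y) (hne : Y.Nonempty)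
include hY hne

theorem norm_sub_proj_eq_iInf (u : Vec d) : ‖u - proj Y u‖ = ⨅ w : Y, ‖u - w‖ := by
  obtain ⟨hmem, hmin⟩ := proj_spec Y hY hne u
  have : Nonempty Y := hne.to_subtype
  exact le_antisymm (le_ciInf fun w => hmin w w.2)
    (ciInf_le ⟨0, by rintro _ ⟨w, rfl⟩; exact norm_nonneg _⟩ (⟨proj Y u, hmem⟩ : Y))

variable (hconv : Convex ℝ Y)
include hconv

theorem inner_sub_proj_le_zero (u : Vec d) {z : Vec d} (hz : z ∈ Y) :
    ⟪u - proj Y u, z - proj Y u⟫ ≤ 0 :=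
  (norm_eq_iInf_iff_real_inner_le_zero hconv (proj_spec Y hY hne u).1).1
    (norm_sub_proj_eq_iInf hY hne u) z hz

theorem norm_proj_sub_proj_le (u v : Vec d) : ‖proj Y u - proj Y v‖ ≤ ‖u - v‖ := by
  have hu := inner_sub_proj_le_zero hY hne hconv u (proj_spec Y hY hne v).1
  have hv := inner_sub_proj_le_zero hY hne hconv v (proj_spec Y hY hne u).1
  have hfirm : ‖proj Y u - proj Y v‖ ^ 2 ≤ ⟪u - v, proj Y u - proj Y v⟫ := by
    rw [← real_inner_self_eq_norm_sq]
    simp only [inner_sub_left, inner_sub_right] at hu hv ⊢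
    linarith
  exact le_of_sq_le_mul (norm_nonneg _) (hfirm.trans (real_inner_le_norm _ _))

theorem continuous_proj : Continuous (proj Y) :=
  (LipschitzWith.mk_one fun u v => by
    simpa only [dist_eq_norm] using norm_proj_sub_proj_le hY hne hconv u v).continuous

end Projection

/-! ### The Moreau envelope of a weakly convex function -/

section Moreau

variable {E : Type*} [NormedAddCommGroup E] {ρ : ℝ} {φ : E → ℝ}

/-- `p` is the proximal point of `x`, where `φ + ρ‖· - x‖²` attains the Moreau envelope of
parameter `1/2ρ`. Quadratic growth away from `p` is part of the definition: for `ρ`-weakly convex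
`φ` it follows from minimality. -/
def IsProx (ρ : ℝ) (φ : E → ℝ) (x p : E) : Prop :=
  ∀ w, φ p + ρ * ‖p - x‖ ^ 2 + ρ / 2 * ‖w - p‖ ^ 2 ≤ φ w + ρ * ‖w - x‖ ^ 2

namespace IsProx

variable {x p : E} (hp : IsProx ρ φ x p) (hρ : 0 < ρ)
include hp hρ

theorem le_add_mul_sq (w : E) : φ p + ρ * ‖p - x‖ ^ 2 ≤ φ w + ρ * ‖w - x‖ ^ 2 := by
  have hgrowth : 0 ≤ ρ / 2 * ‖w - p‖ ^ 2 := by positivity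
  linarith [hp w]

theorem moreauEnvelope_eq : moreauEnvelope φ (1 / (2 * ρ)) x = φ p + ρ * ‖p - x‖ ^ 2 := by
  have hcoef : 1 / (2 * (1 / (2 * ρ))) = ρ := by field_simp
  rw [moreauEnvelope, hcoef]
  have hmin := hp.le_add_mul_sq hρ
  exact le_antisymm (ciInf_le ⟨_, by rintro _ ⟨w, rfl⟩; exact hmin w⟩ p) (le_ciInf hmin)

theorem moreauEnvelope_le (w : E) :
    moreauEnvelope φ (1 / (2 * ρ)) x ≤ φ w + ρ * ‖w - x‖ ^ 2 :=
  (hp.moreauEnvelope_eq hρ).trans_le (hp.le_add_mul_sq hρ w)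

theorem moreauEnvelope_le_self : moreauEnvelope φ (1 / (2 * ρ)) x ≤ φ x := by
  simpa using hp.moreauEnvelope_le hρ x

theorem iInf_le_moreauEnvelope (hbdd : BddBelow (Set.range φ)) :
    ⨅ w, φ w ≤ moreauEnvelope φ (1 / (2 * ρ)) x := by
  rw [hp.moreauEnvelope_eq hρ]
  exact le_add_of_le_of_nonneg (ciInf_le hbdd p) (by positivity)

theorem norm_sub_le {K : ℝ≥0} (hφ : LipschitzWith K φ) : ‖p - x‖ ≤ K / ρ := by
  have hmin := hp.le_add_mul_sq hρ x
  have hlip := hφ.le_add_mul x p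
  rw [dist_comm, dist_eq_norm] at hlip
  rw [sub_self, norm_zero] at hmin
  refine le_of_sq_le_mul (by positivity) ?_
  rw [div_mul_eq_mul_div, le_div_iff₀ hρ]
  linarith

end IsProx

variable [InnerProductSpace ℝ E]

theorem convexOn_univ_of_exists_support
    (h : ∀ z, ∃ v, ∀ w, φ z + ⟪v, w - z⟫ ≤ φ w) : ConvexOn ℝ Set.univ φ := by
  refine ⟨convex_univ, fun a _ b _ s t hs ht hst => ?_⟩
  obtain ⟨v, hv⟩ := h (s • a + t • b)
  have hbary : s * ⟪v, a - (s • a + t • b)⟫ + t * ⟪v, b - (s • a + t • b)⟫ = 0 := by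
    obtain rfl : s = 1 - t := by linarith
    simp only [inner_sub_right, inner_add_right, real_inner_smul_right]
    ring
  have ha := mul_le_mul_of_nonneg_left (hv a) hs
  have hb := mul_le_mul_of_nonneg_left (hv b) ht
  simp only [smul_eq_mul]
  linear_combination ha + hb - hbary - φ (s • a + t • b) * hst

theorem isWeaklyConvex_of_exists_support
    (h : ∀ z, ∃ v, ∀ w, φ z + ⟪v, w - z⟫ - ρ / 2 * ‖w - z‖ ^ 2 ≤ φ w) : IsWeaklyConvex ρ φ := by
  refine convexOn_univ_of_exists_support fun z => ?_
  obtain ⟨v, hv⟩ := h z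
  refine ⟨v + ρ • z, fun w => ?_⟩
  have hw := hv w
  rw [norm_sub_sq_real, real_inner_comm z w] at hw
  rw [inner_add_left, real_inner_smul_left, inner_sub_right z, real_inner_self_eq_norm_sq]
  linarith

theorem IsWeaklyConvex.isProx_of_minimizer (hφ : IsWeaklyConvex ρ φ) {x p : E}
    (hp : ∀ w, φ p + ρ * ‖p - x‖ ^ 2 ≤ φ w + ρ * ‖w - x‖ ^ 2) : IsProx ρ φ x p := by
  intro w
  refine le_of_forall_le_add_mul (c := ρ / 2 * ‖w - p‖ ^ 2) fun t ht ht1 => ?_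
  have hconv := hφ.2 (Set.mem_univ p) (Set.mem_univ w) (sub_nonneg.2 ht1) ht.le (by ring)
  have hmin := hp ((1 - t) • p + t • w)
  refine le_of_mul_le_mul_left ?_ ht
  simp only [smul_eq_mul, ← real_inner_self_eq_norm_sq, inner_add_left, inner_add_right,
    inner_sub_left, inner_sub_right, real_inner_smul_left, real_inner_smul_right,
    real_inner_comm p w, real_inner_comm x] at hconv hmin ⊢
  linear_combination hconv + hmin

theorem IsWeaklyConvex.exists_isProx [ProperSpace E] (hφ : IsWeaklyConvex ρ φ) (hρ : 0 < ρ)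
    (hcont : Continuous φ) (hbdd : BddBelow (Set.range φ)) (x : E) : ∃ p, IsProx ρ φ x p := by
  obtain ⟨b, hb⟩ := hbdd
  obtain ⟨p, hp⟩ := Continuous.exists_forall_le' (f := fun w => φ w + ρ * ‖w - x‖ ^ 2)
    (by fun_prop) x (by
    filter_upwards [(isCompact_closedBall x (√((φ x - b) / ρ))).compl_mem_cocompact] with w hw
    rw [Set.mem_compl_iff, Metric.mem_closedBall, not_le, dist_eq_norm] at hw
    have hfar := Real.lt_sq_of_sqrt_lt hw
    rw [div_lt_iff₀ hρ] at hfar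
    have hbw : b ≤ φ w := hb ⟨w, rfl⟩
    simp only [sub_self, norm_zero]
    linarith)
  exact ⟨p, hφ.isProx_of_minimizer hp⟩

namespace IsProx

variable {x p x' p' : E} (hp : IsProx ρ φ x p) (hp' : IsProx ρ φ x' p') (hρ : 0 < ρ)
include hp hp' hρ

theorem norm_sub_le_two_mul : ‖p' - p‖ ≤ 2 * ‖x' - x‖ := by
  refine le_of_sq_le_mul (by positivity) ?_
  have hgrowth := hp p'
  have hgrowth' := hp' p
  have hcs := real_inner_le_norm (p' - p) (x' - x)
  have hmono : ρ * ‖p' - p‖ ^ 2 ≤ ρ * (2 * ⟪p' - p, x' - x⟫) := by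
    simp only [← real_inner_self_eq_norm_sq, inner_sub_left, inner_sub_right,
      real_inner_comm p p', real_inner_comm x, real_inner_comm x'] at hgrowth hgrowth' ⊢
    linarith
  linarith [le_of_mul_le_mul_left hmono hρ]

theorem moreauEnvelope_le_quadratic :
    moreauEnvelope φ (1 / (2 * ρ)) x' ≤ moreauEnvelope φ (1 / (2 * ρ)) x +
      ⟪(2 * ρ) • (x - p), x' - x⟫ + ρ * ‖x' - x‖ ^ 2 := by
  have hle := hp'.moreauEnvelope_le hρ p
  rw [hp.moreauEnvelope_eq hρ]
  have hexpand : ‖p - x'‖ ^ 2 = ‖p - x‖ ^ 2 + 2 * ⟪x - p, x' - x⟫ + ‖x' - x‖ ^ 2 := by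
    rw [← sub_sub_sub_cancel_right p x' x, norm_sub_sq_real, ← neg_sub p x, inner_neg_left]
    ring
  rw [hexpand] at hle
  rw [real_inner_smul_left]
  linarith

theorem quadratic_le_moreauEnvelope :
    moreauEnvelope φ (1 / (2 * ρ)) x + ⟪(2 * ρ) • (x - p), x' - x⟫ - 3 * ρ * ‖x' - x‖ ^ 2 ≤
      moreauEnvelope φ (1 / (2 * ρ)) x' := by
  have hle := hp'.moreauEnvelope_le_quadratic hp hρ
  have hprox : ⟪p' - p, x' - x⟫ ≤ 2 * ‖x' - x‖ * ‖x' - x‖ :=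
    (real_inner_le_norm _ _).trans
      (mul_le_mul_of_nonneg_right (hp.norm_sub_le_two_mul hp' hρ) (norm_nonneg _))
  have hswap : ⟪(2 * ρ) • (x' - p'), x - x'⟫ =
      2 * ρ * ⟪p' - p, x' - x⟫ - ⟪(2 * ρ) • (x - p), x' - x⟫ - 2 * ρ * ‖x' - x‖ ^ 2 := by
    simp only [← real_inner_self_eq_norm_sq, real_inner_smul_left, inner_sub_left, inner_sub_right]
    ring
  rw [hswap, norm_sub_rev x x'] at hle
  linarith [mul_le_mul_of_nonneg_left hprox hρ.le]

end IsProx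

section ProxMap

variable {p : E → E} (hp : ∀ x, IsProx ρ φ x (p x)) (hρ : 0 < ρ)
include hp hρ

theorem continuous_prox : Continuous p :=
  (LipschitzWith.of_dist_le' (K := 2) fun x x' => by
    simpa only [dist_eq_norm] using (hp x').norm_sub_le_two_mul (hp x) hρ).continuous

theorem hasGradientAt_moreauEnvelope [CompleteSpace E] (x : E) :
    HasGradientAt (moreauEnvelope φ (1 / (2 * ρ))) ((2 * ρ) • (x - p x)) x := by
  refine hasGradientAt_of_abs_sub_le_mul_sq (3 * ρ) fun x' => abs_le.2 ⟨?_, ?_⟩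
  · linarith [(hp x).quadratic_le_moreauEnvelope (hp x') hρ]
  · have hsq : 0 ≤ ρ * ‖x' - x‖ ^ 2 := by positivity
    linarith [(hp x).moreauEnvelope_le_quadratic (hp x') hρ]

theorem differentiable_moreauEnvelope [CompleteSpace E] :
    Differentiable ℝ (moreauEnvelope φ (1 / (2 * ρ))) :=
  fun x => (hasGradientAt_moreauEnvelope hp hρ x).differentiableAt

theorem norm_gradient_moreauEnvelope [CompleteSpace E] (x : E) :
    ‖gradient (moreauEnvelope φ (1 / (2 * ρ))) x‖ = 2 * ρ * ‖p x - x‖ := by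
  rw [(hasGradientAt_moreauEnvelope hp hρ x).gradient, norm_smul, norm_sub_rev,
    Real.norm_of_nonneg (by positivity)]

end ProxMap

end Moreau

/-! ### The minimax objective -/

section Partial

variable {m n : ℕ} {f : Vec m → Vec n → ℝ} {ℓ : ℝ}

theorem norm_mkPair_sub_mkPair_left (x x' : Vec m) (y : Vec n) :
    ‖mkPair x y - mkPair x' y‖ = ‖x - x'‖ := by
  simp [mkPair, ← WithLp.toLp_sub]

theorem norm_mkPair_sub_mkPair_right (x : Vec m) (y y' : Vec n) :
    ‖mkPair x y - mkPair x y'‖ = ‖y - y'‖ := by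
  simp [mkPair, ← WithLp.toLp_sub]

theorem inner_mkPair_zero_right (v : VecPair m n) (x : Vec m) : ⟪v, mkPair x 0⟫ = ⟪v.fst, x⟫ := by
  simp [WithLp.prod_inner_apply, mkPair]

theorem inner_mkPair_zero_left (v : VecPair m n) (y : Vec n) : ⟪v, mkPair 0 y⟫ = ⟪v.snd, y⟫ := by
  simp [WithLp.prod_inner_apply, mkPair]

theorem norm_mkPair_zero_right (x : Vec m) : ‖(mkPair x 0 : VecPair m n)‖ = ‖x‖ := by
  simp [mkPair]

theorem norm_mkPair_zero_left (y : Vec n) : ‖(mkPair 0 y : VecPair m n)‖ = ‖y‖ := by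
  simp [mkPair]

theorem continuous_mkPair : Continuous fun p : Vec m × Vec n => mkPair p.1 p.2 :=
  WithLp.prod_continuous_toLp 2 _ _

theorem hasGradientAt_left {x : Vec m} {y : Vec n}
    (hf : DifferentiableAt ℝ (joint f) (mkPair x y)) :
    HasGradientAt (fun x => f x y) (grad f x y).fst x := by
  have hpair : HasFDerivAt (fun x : Vec m => mkPair x y)
      ((WithLp.prodContinuousLinearEquiv 2 ℝ (Vec m) (Vec n)).symm.toContinuousLinearMap.comp
        (.inl ℝ (Vec m) (Vec n))) x :=
    (WithLp.prodContinuousLinearEquiv 2 ℝ (Vec m) (Vec n)).symm.hasFDerivAt.comp x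
      (hasFDerivAt_prodMk_left x y)
  refine (hf.hasGradientAt.hasFDerivAt.comp x hpair).congr_fderiv ?_
  ext d
  exact inner_mkPair_zero_right (grad f x y) d

theorem hasGradientAt_right {x : Vec m} {y : Vec n}
    (hf : DifferentiableAt ℝ (joint f) (mkPair x y)) :
    HasGradientAt (f x) (grad f x y).snd y := by
  have hpair : HasFDerivAt (fun y : Vec n => mkPair x y)
      ((WithLp.prodContinuousLinearEquiv 2 ℝ (Vec m) (Vec n)).symm.toContinuousLinearMap.comp
        (.inr ℝ (Vec m) (Vec n))) y :=
    (WithLp.prodContinuousLinearEquiv 2 ℝ (Vec m) (Vec n)).symm.hasFDerivAt.comp y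
      (hasFDerivAt_prodMk_right x y)
  refine (hf.hasGradientAt.hasFDerivAt.comp y hpair).congr_fderiv ?_
  ext d
  exact inner_mkPair_zero_left (grad f x y) d

section

variable (hf : IsSmooth ℓ (joint f))
include hf

theorem gradient_left (x : Vec m) (y : Vec n) :
    gradient (fun x => f x y) x = (grad f x y).fst :=
  (hasGradientAt_left (hf.1 _)).gradient

theorem gradient_right (x : Vec m) (y : Vec n) : gradient (f x) y = (grad f x y).snd :=
  (hasGradientAt_right (hf.1 _)).gradient

theorem isSmooth_left (y : Vec n) : IsSmooth ℓ fun x => f x y := by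
  refine ⟨fun x => (hasGradientAt_left (hf.1 _)).differentiableAt, fun x x' => ?_⟩
  rw [gradient_left hf, gradient_left hf, ← norm_mkPair_sub_mkPair_left x x' y, ← WithLp.sub_fst]
  exact (WithLp.norm_fst_le _ _).trans (hf.2 _ _)

theorem isSmooth_right (x : Vec m) : IsSmooth ℓ (f x) := by
  refine ⟨fun y => (hasGradientAt_right (hf.1 _)).differentiableAt, fun y y' => ?_⟩
  rw [gradient_right hf, gradient_right hf, ← norm_mkPair_sub_mkPair_right x y y',
    ← WithLp.sub_snd]
  exact (WithLp.norm_snd_le _ _).trans (hf.2 _ _)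

theorem continuous_uncurry : Continuous fun p : Vec m × Vec n => f p.1 p.2 :=
  hf.continuous.comp continuous_mkPair

theorem continuous_grad : Continuous fun p : Vec m × Vec n => grad f p.1 p.2 :=
  hf.continuous_gradient.comp continuous_mkPair

theorem quadratic_le_left (x x' : Vec m) (y : Vec n) :
    f x y + ⟪(grad f x y).fst, x' - x⟫ - ℓ / 2 * ‖x' - x‖ ^ 2 ≤ f x' y := by
  simpa only [gradient_left hf] using (isSmooth_left hf y).quadratic_le x x'

end

end Partial

/-- The Moreau envelope `Φ_{1/2ℓ}` of `Φ = maxFun f Y`. -/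
abbrev envelope {m n : ℕ} (f : Vec m → Vec n → ℝ) (Y : Set (Vec n)) (ℓ : ℝ) : Vec m → ℝ :=
  moreauEnvelope (maxFun f Y) (1 / (2 * ℓ))

/-- `f(x, y) - ‖z - y‖² / 2η`: a step of projected ascent in `y` of size `η` increases it by at
least the gap `f(x, z) - f(x, y)`, up to gradient noise. -/
def potential {m n : ℕ} (f : Vec m → Vec n → ℝ) (η : ℝ) (z : Vec n) (x : Vec m) (y : Vec n) : ℝ :=
  f x y - ‖z - y‖ ^ 2 / (2 * η)

namespace SmoothNonconvexConcave

variable {m n : ℕ} {f : Vec m → Vec n → ℝ} {Y : Set (Vec n)} {ℓ L D : ℝ}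
  (h : SmoothNonconvexConcave f Y ℓ L D)
include h

theorem lipschitzWith_left {y : Vec n} (hy : y ∈ Y) :
    LipschitzWith L.toNNReal fun x => f x y :=
  LipschitzWith.of_dist_le' fun x x' => by
    simpa only [dist_eq_norm, Real.norm_eq_abs] using h.lipschitz y hy x x'

theorem norm_grad_fst_le (x : Vec m) {y : Vec n} (hy : y ∈ Y) : ‖(grad f x y).fst‖ ≤ L :=
  (norm_le_of_hasGradientAt_of_lipschitzWith (h.lipschitzWith_left hy)
    (hasGradientAt_left (h.smooth.1 _))).trans_eq (Real.coe_toNNReal L h.L_pos.le)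

theorem isCompact : IsCompact Y :=
  Metric.isCompact_of_isClosed_isBounded h.closed h.bounded

theorem nonempty : Y.Nonempty := by
  rw [Set.nonempty_iff_ne_empty]
  rintro rfl
  exact h.D_pos.ne (Metric.diam_empty.symm.trans h.diam)

theorem norm_sub_le {y z : Vec n} (hy : y ∈ Y) (hz : z ∈ Y) : ‖y - z‖ ≤ D := by
  rw [← dist_eq_norm, ← h.diam]
  exact Metric.dist_le_diam_of_mem h.bounded hy hz

theorem proj_mem (u : Vec n) : proj Y u ∈ Y :=
  (proj_spec Y h.closed h.nonempty u).1

theorem isGreatest_maxFun (x : Vec m) : IsGreatest (f x '' Y) (maxFun f Y x) :=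
  maxFun_isGreatest f Y x (isSmooth_right h.smooth x).continuous h.isCompact h.nonempty

theorem le_maxFun (x : Vec m) {y : Vec n} (hy : y ∈ Y) : f x y ≤ maxFun f Y x :=
  (h.isGreatest_maxFun x).2 ⟨y, hy, rfl⟩

theorem exists_eq_maxFun (x : Vec m) : ∃ y ∈ Y, f x y = maxFun f Y x :=
  (h.isGreatest_maxFun x).1

theorem lipschitzWith_maxFun : LipschitzWith L.toNNReal (maxFun f Y) := by
  refine LipschitzWith.of_le_add_mul _ fun x x' => ?_
  obtain ⟨y, hy, hxy⟩ := h.exists_eq_maxFun x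
  rw [← hxy]
  exact ((h.lipschitzWith_left hy).le_add_mul x x').trans (by gcongr; exact h.le_maxFun x' hy)

theorem isWeaklyConvex : IsWeaklyConvex ℓ (maxFun f Y) := by
  refine isWeaklyConvex_of_exists_support fun x => ?_
  obtain ⟨y, hy, hxy⟩ := h.exists_eq_maxFun x
  refine ⟨(grad f x y).fst, fun w => ?_⟩
  rw [← hxy]
  exact (quadratic_le_left h.smooth x w y).trans (h.le_maxFun w hy)

theorem exists_proxMap (hbdd : BddBelow (Set.range (maxFun f Y))) :
    ∃ p : Vec m → Vec m, ∀ x, IsProx ℓ (maxFun f Y) x (p x) :=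
  Classical.skolem.1 fun x =>
    h.isWeaklyConvex.exists_isProx h.ell_pos h.lipschitzWith_maxFun.continuous hbdd x

section Prox

variable {p : Vec m → Vec m} (hp : ∀ x, IsProx ℓ (maxFun f Y) x (p x))
include hp

theorem norm_prox_sub_le (x : Vec m) : ‖p x - x‖ ≤ L / ℓ := by
  simpa only [Real.coe_toNNReal L h.L_pos.le] using
    (hp x).norm_sub_le h.ell_pos h.lipschitzWith_maxFun

theorem norm_gradient_envelope_le (x : Vec m) : ‖gradient (envelope f Y ℓ) x‖ ≤ 2 * L := by
  have hℓ := h.ell_pos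
  have hprox := h.norm_prox_sub_le hp x
  rw [le_div_iff₀ hℓ] at hprox
  rw [norm_gradient_moreauEnvelope hp hℓ]
  linarith

theorem continuous_norm_gradient_envelope :
    Continuous fun x => ‖gradient (envelope f Y ℓ) x‖ := by
  have hcont := continuous_prox hp h.ell_pos
  simp_rw [norm_gradient_moreauEnvelope hp h.ell_pos]
  fun_prop

theorem inner_grad_prox_sub_le (x : Vec m) {y : Vec n} (hy : y ∈ Y) :
    ⟪(grad f x y).fst, p x - x⟫ ≤ maxFun f Y x - f x y - ℓ * ‖p x - x‖ ^ 2 := by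
  have hprox := hp x x
  have hsmooth := (quadratic_le_left h.smooth x (p x) y).trans (h.le_maxFun (p x) hy)
  rw [sub_self, norm_zero, norm_sub_rev x (p x)] at hprox
  linarith

theorem envelope_step_le (x : Vec m) {y : Vec n} (hy : y ∈ Y) (g : VecPair m n) {η : ℝ}
    (hη : 0 ≤ η) :
    envelope f Y ℓ (x - η • g.fst) ≤ envelope f Y ℓ x + 2 * η * ℓ * (maxFun f Y x - f x y) -
      η / 2 * ‖gradient (envelope f Y ℓ) x‖ ^ 2 +
      2 * η * ℓ * ⟪g - grad f x y, mkPair (p x - x) 0⟫ + η ^ 2 * ℓ * ‖g.fst‖ ^ 2 := by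
  have hquad := (hp x).moreauEnvelope_le_quadratic (hp (x - η • g.fst)) h.ell_pos
  have hdir := mul_le_mul_of_nonneg_left (h.inner_grad_prox_sub_le hp x hy)
    (mul_nonneg hη h.ell_pos.le)
  have hinner : ⟪(2 * ℓ) • (x - p x), x - η • g.fst - x⟫ = 2 * η * ℓ * ⟪g.fst, p x - x⟫ := by
    rw [sub_sub_cancel_left, ← neg_sub (p x) x, smul_neg, inner_neg_neg, real_inner_smul_left,
      real_inner_smul_right, real_inner_comm]
    ring
  rw [hinner, sub_sub_cancel_left, norm_neg, norm_smul, Real.norm_of_nonneg hη] at hquad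
  rw [norm_gradient_moreauEnvelope hp h.ell_pos, inner_mkPair_zero_right, WithLp.sub_fst,
    inner_sub_left]
  linarith

end Prox

theorem le_potential_sub (x : Vec m) {y z : Vec n} (hy : y ∈ Y) (hz : z ∈ Y) (g : VecPair m n)
    {η : ℝ} (hη : 0 < η) (hstep : η * ℓ ≤ 1 / 2 ∨ η * ℓ ≤ 1 ∧ g - grad f x y = 0) :
    f x z - f x y ≤ potential f η z x (proj Y (y + η • g.snd)) - potential f η z x y +
      η * ‖g - grad f x y‖ ^ 2 - ⟪g - grad f x y, mkPair 0 (z - y)⟫ := by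
  have hvar := inner_sub_proj_le_zero h.closed h.nonempty h.convex (y + η • g.snd) hz
  have hascent := le_ascent_step (isSmooth_right h.smooth x) (h.concave x) hy hz hη hvar
    (by
      rw [gradient_right h.smooth, ← WithLp.sub_snd]
      exact hstep.imp_right fun hs => ⟨hs.1, by rw [hs.2]; rfl⟩)
  rw [gradient_right h.smooth, ← WithLp.sub_snd] at hascent
  have hsnd : η * ‖(g - grad f x y).snd‖ ^ 2 ≤ η * ‖g - grad f x y‖ ^ 2 := by
    gcongr
    exact WithLp.norm_snd_le _ _
  rw [inner_mkPair_zero_left, potential, potential]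
  rw [sub_div] at hascent
  linarith

theorem potential_le_add (x : Vec m) {y : Vec n} (hy : y ∈ Y) (z : Vec n) (g : Vec m) {η ηx : ℝ}
    (hηx : 0 ≤ ηx) : potential f η z x y ≤ potential f η z (x - ηx • g) y + ηx * (L * ‖g‖) := by
  have hlip := (le_abs_self _).trans (h.lipschitz y hy x (x - ηx • g))
  rw [sub_sub_cancel, norm_smul, Real.norm_of_nonneg hηx] at hlip
  rw [potential, potential]
  linarith

theorem norm_fst_sq_le (x : Vec m) {y : Vec n} (hy : y ∈ Y) (g : VecPair m n) :
    ‖g.fst‖ ^ 2 ≤ L ^ 2 + ‖g - grad f x y‖ ^ 2 +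
      2 * ⟪g - grad f x y, mkPair (grad f x y).fst 0⟫ := by
  have hsplit : g.fst = (g - grad f x y).fst + (grad f x y).fst := by
    rw [WithLp.sub_fst, sub_add_cancel]
  have hnoise := pow_le_pow_left₀ (norm_nonneg _) (WithLp.norm_fst_le _ (g - grad f x y)) 2
  have hgrad := pow_le_pow_left₀ (norm_nonneg _) (h.norm_grad_fst_le x hy) 2
  rw [inner_mkPair_zero_right, hsplit, norm_add_sq_real]
  linarith

theorem exists_abs_le : ∃ C, ∀ x, ∀ y ∈ Y, |f x y| ≤ C + L * ‖x‖ := by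
  obtain ⟨C, hC⟩ := (h.isCompact.image (isSmooth_right h.smooth 0).continuous).isBounded
    |>.exists_norm_le
  refine ⟨C, fun x y hy => ?_⟩
  have hlip := h.lipschitz y hy x 0
  have hzero : |f 0 y| ≤ C := hC _ ⟨y, hy, rfl⟩
  rw [sub_zero] at hlip
  linarith [abs_sub_abs_le_abs_sub (f x y) (f 0 y)]

end SmoothNonconvexConcave

/-! ### Noisy runs -/

/-- The error of the gradient estimate `g t` at the iterate `(x t, y t)`. -/
def noise {m n : ℕ} {Ω : Type*} (f : Vec m → Vec n → ℝ) (x : ℕ → Ω → Vec m) (y : ℕ → Ω → Vec n)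
    (g : ℕ → Ω → VecPair m n) (t : ℕ) (ω : Ω) : VecPair m n :=
  g t ω - grad f (x t ω) (y t ω)

/-- The iterates `(x t, y t)` of projected gradient descent ascent driven by gradient estimates
`g t` whose errors have variance at most `σ²` and are conditionally centered given the past `ℱ t`;
the latter is expressed as orthogonality to all bounded `ℱ t`-measurable vectors. -/
structure IsNoisyRun {m n : ℕ} {Ω : Type*} {mΩ : MeasurableSpace Ω} (f : Vec m → Vec n → ℝ)
    (Y : Set (Vec n)) (ηx ηy σ : ℝ) (x₀ : Vec m) (y₀ : Vec n) (P : Measure Ω)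
    (ℱ : Filtration ℕ mΩ) (x : ℕ → Ω → Vec m) (y : ℕ → Ω → Vec n)
    (g : ℕ → Ω → VecPair m n) : Prop where
  start_mem : y₀ ∈ Y
  x_zero : ∀ ω, x 0 ω = x₀
  y_zero : ∀ ω, y 0 ω = y₀
  x_succ : ∀ t ω, x (t + 1) ω = x t ω - ηx • (g t ω).fst
  y_succ : ∀ t ω, y (t + 1) ω = proj Y (y t ω + ηy • (g t ω).snd)
  x_measurable : ∀ t, Measurable[ℱ t] (x t)
  y_measurable : ∀ t, Measurable[ℱ t] (y t)
  noise_memLp : ∀ t, MemLp (noise f x y g t) 2 P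
  noise_variance : ∀ t, ∫ ω, ‖noise f x y g t ω‖ ^ 2 ∂P ≤ σ ^ 2
  noise_orthogonal : ∀ t (W : Ω → VecPair m n) (C : ℝ), Measurable[ℱ t] W →
    (∀ ω, ‖W ω‖ ≤ C) → ∫ ω, ⟪noise f x y g t ω, W ω⟫ ∂P = 0

/-- The expected primal gap `𝔼[Φ(x t) - f(x t, y t)]`. -/
def expectedGap {m n : ℕ} {Ω : Type*} [MeasurableSpace Ω] (f : Vec m → Vec n → ℝ)
    (Y : Set (Vec n)) (P : Measure Ω) (x : ℕ → Ω → Vec m) (y : ℕ → Ω → Vec n) (t : ℕ) : ℝ :=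
  ∫ ω, (maxFun f Y (x t ω) - f (x t ω) (y t ω)) ∂P

theorem integrable_norm_sq {Ω E : Type*} [MeasurableSpace Ω] {P : Measure Ω}
    [NormedAddCommGroup E] {X : Ω → E} (hX : MemLp X 2 P) : Integrable (fun ω => ‖X ω‖ ^ 2) P :=
  (memLp_two_iff_integrable_sq_norm hX.1).1 hX

namespace IsNoisyRun

variable {m n : ℕ} {f : Vec m → Vec n → ℝ} {Y : Set (Vec n)} {ℓ L D ηx ηy σ : ℝ}
  {x₀ : Vec m} {y₀ : Vec n} {Ω : Type*} {mΩ : MeasurableSpace Ω} {P : Measure Ω}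
  {ℱ : Filtration ℕ mΩ} {x : ℕ → Ω → Vec m} {y : ℕ → Ω → Vec n} {g : ℕ → Ω → VecPair m n}
  (r : IsNoisyRun f Y ηx ηy σ x₀ y₀ P ℱ x y g)
include r

theorem measurable_x (t : ℕ) : Measurable (x t) :=
  (r.x_measurable t).mono (ℱ.le t) le_rfl

theorem measurable_y (t : ℕ) : Measurable (y t) :=
  (r.y_measurable t).mono (ℱ.le t) le_rfl

theorem noise_ae_eq_zero (hσ : σ = 0) (t : ℕ) : noise f x y g t =ᵐ[P] 0 := by
  have hzero : ∫ ω, ‖noise f x y g t ω‖ ^ 2 ∂P = 0 :=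
    ((r.noise_variance t).trans_eq (by simp [hσ])).antisymm
      (integral_nonneg fun ω => sq_nonneg _)
  filter_upwards [(integral_eq_zero_iff_of_nonneg (fun ω => sq_nonneg _)
    (integrable_norm_sq (r.noise_memLp t))).1 hzero] with ω hω
  simpa using hω

theorem integrable_inner_noise [IsFiniteMeasure P] (t : ℕ) {W : Ω → VecPair m n} {C : ℝ}
    (hW : Measurable W) (hC : ∀ ω, ‖W ω‖ ≤ C) :
    Integrable (fun ω => ⟪noise f x y g t ω, W ω⟫) P := by
  have hbound : Integrable (fun ω => ‖noise f x y g t ω‖ * C) P :=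
    ((r.noise_memLp t).integrable one_le_two).norm.mul_const C
  refine hbound.mono' ((r.noise_memLp t).1.inner hW.aestronglyMeasurable) (.of_forall fun ω => ?_)
  exact (norm_inner_le_norm _ _).trans (by gcongr; exact hC ω)

variable (h : SmoothNonconvexConcave f Y ℓ L D)
include h

theorem y_mem (t : ℕ) (ω : Ω) : y t ω ∈ Y := by
  cases t with
  | zero => exact r.y_zero ω ▸ r.start_mem
  | succ t => exact r.y_succ t ω ▸ h.proj_mem _

theorem measurable_grad (t : ℕ) : Measurable[ℱ t] fun ω => grad f (x t ω) (y t ω) :=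
  (continuous_grad h.smooth).measurable.comp ((r.x_measurable t).prodMk (r.y_measurable t))

theorem ae_sub_le_potential_sub (hηx : 0 ≤ ηx) (hηy : 0 < ηy)
    (hstep : ηy * ℓ ≤ 1 / 2 ∨ ηy * ℓ ≤ 1 ∧ σ = 0) (t : ℕ) {z : Ω → Vec n} (hzY : ∀ ω, z ω ∈ Y) :
    ∀ᵐ ω ∂P, f (x t ω) (z ω) - f (x t ω) (y t ω) ≤
      potential f ηy (z ω) (x (t + 1) ω) (y (t + 1) ω) - potential f ηy (z ω) (x t ω) (y t ω) +
      ηx * (L * ‖(g t ω).fst‖) + ηy * ‖noise f x y g t ω‖ ^ 2 -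
      ⟪noise f x y g t ω, mkPair 0 (z ω - y t ω)⟫ := by
  have hnoise : ∀ᵐ ω ∂P, ηy * ℓ ≤ 1 / 2 ∨ ηy * ℓ ≤ 1 ∧ noise f x y g t ω = 0 := by
    rcases hstep with hsmall | ⟨hle, hσ⟩
    · exact .of_forall fun _ => .inl hsmall
    · filter_upwards [r.noise_ae_eq_zero hσ t] with ω hω using .inr ⟨hle, hω⟩
  filter_upwards [hnoise] with ω hω
  have hascent := h.le_potential_sub (x t ω) (r.y_mem h t ω) (hzY ω) (g t ω) hηy hω
  have hdescent := h.potential_le_add (x t ω) (r.y_mem h (t + 1) ω) (z ω) (g t ω).fst (η := ηy) hηx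
  rw [← r.y_succ] at hascent
  rw [← r.x_succ] at hdescent
  unfold noise
  linarith

section Integrability

variable [IsFiniteMeasure P]

theorem memLp_fst (t : ℕ) : MemLp (fun ω => (g t ω).fst) 2 P := by
  have hgrad : MemLp (fun ω => (grad f (x t ω) (y t ω)).fst) 2 P :=
    .of_bound ((WithLp.continuous_fst 2 _ _).measurable.comp
      ((r.measurable_grad h t).mono (ℱ.le t) le_rfl)).aestronglyMeasurable L
      (.of_forall fun ω => h.norm_grad_fst_le _ (r.y_mem h t ω))
  have hnoise : MemLp (fun ω => (noise f x y g t ω).fst) 2 P :=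
    (r.noise_memLp t).mono
      ((WithLp.continuous_fst 2 _ _).comp_aestronglyMeasurable (r.noise_memLp t).1)
      (.of_forall fun ω => WithLp.norm_fst_le _ _)
  convert hnoise.add hgrad using 1
  ext1 ω
  simp [noise]

theorem memLp_x (t : ℕ) : MemLp (x t) 2 P := by
  induction t with
  | zero => simpa only [funext r.x_zero] using memLp_const x₀
  | succ t ih =>
    rw [show x (t + 1) = x t - ηx • fun ω => (g t ω).fst from funext (r.x_succ t)]
    exact ih.sub ((r.memLp_fst h t).const_smul ηx)

theorem integrable_norm_fst (t : ℕ) : Integrable (fun ω => ‖(g t ω).fst‖) P :=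
  ((r.memLp_fst h t).integrable one_le_two).norm

theorem integrable_norm_sub (s t : ℕ) : Integrable (fun ω => ‖x t ω - x s ω‖) P :=
  (((r.memLp_x h t).sub (r.memLp_x h s)).integrable one_le_two).norm

theorem integrable_of_abs_le_add_mul_norm {X : Ω → ℝ} (hX : Measurable X) {C K : ℝ} {t : ℕ}
    (hXC : ∀ ω, |X ω| ≤ C + K * ‖x t ω‖) : Integrable X P :=
  ((integrable_const C).add
    (((r.memLp_x h t).integrable one_le_two).norm.const_mul K)).mono' hX.aestronglyMeasurable
    (.of_forall hXC)

theorem integrable_maxFun (t : ℕ) : Integrable (fun ω => maxFun f Y (x t ω)) P := by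
  obtain ⟨C, hC⟩ := h.exists_abs_le
  have hbound (ω : Ω) : |maxFun f Y (x t ω)| ≤ C + L * ‖x t ω‖ := by
    obtain ⟨z, hz, hxz⟩ := h.exists_eq_maxFun (x t ω)
    exact hxz ▸ hC (x t ω) z hz
  exact r.integrable_of_abs_le_add_mul_norm h
    (h.lipschitzWith_maxFun.continuous.measurable.comp (r.measurable_x t)) hbound

theorem integrable_apply {z : Ω → Vec n} (hz : Measurable z) (hzY : ∀ ω, z ω ∈ Y) (t : ℕ) :
    Integrable (fun ω => f (x t ω) (z ω)) P := by
  obtain ⟨C, hC⟩ := h.exists_abs_le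
  exact r.integrable_of_abs_le_add_mul_norm h
    ((continuous_uncurry h.smooth).measurable.comp ((r.measurable_x t).prodMk hz))
    fun ω => hC _ _ (hzY ω)

theorem integrable_f (t : ℕ) : Integrable (fun ω => f (x t ω) (y t ω)) P :=
  r.integrable_apply h (r.measurable_y t) (r.y_mem h t) t

theorem integrable_norm_sub_sq {z : Ω → Vec n} (hz : Measurable z) (hzY : ∀ ω, z ω ∈ Y) (t : ℕ) :
    Integrable (fun ω => ‖z ω - y t ω‖ ^ 2) P :=
  integrable_norm_sq <| .of_bound (hz.sub (r.measurable_y t)).aestronglyMeasurable D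
    (.of_forall fun ω => h.norm_sub_le (hzY ω) (r.y_mem h t ω))

theorem integrable_potential {z : Ω → Vec n} (hz : Measurable z) (hzY : ∀ ω, z ω ∈ Y) (t : ℕ) :
    Integrable (fun ω => potential f ηy (z ω) (x t ω) (y t ω)) P :=
  (r.integrable_f h t).sub ((r.integrable_norm_sub_sq h hz hzY t).div_const _)

theorem expectedGap_eq (t : ℕ) :
    expectedGap f Y P x y t = ∫ ω, maxFun f Y (x t ω) ∂P - ∫ ω, f (x t ω) (y t ω) ∂P :=
  integral_sub (r.integrable_maxFun h t) (r.integrable_f h t)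

end Integrability

variable [IsProbabilityMeasure P]

theorem integral_norm_fst_sq_le (t : ℕ) : ∫ ω, ‖(g t ω).fst‖ ^ 2 ∂P ≤ L ^ 2 + σ ^ 2 := by
  set W : Ω → VecPair m n := fun ω => mkPair (grad f (x t ω) (y t ω)).fst 0
  have hWm : Measurable[ℱ t] W := continuous_mkPair.measurable.comp
    (((WithLp.continuous_fst 2 _ _).measurable.comp (r.measurable_grad h t)).prodMk
      measurable_const)
  have hWb (ω : Ω) : ‖W ω‖ ≤ L := by
    rw [norm_mkPair_zero_right]
    exact h.norm_grad_fst_le _ (r.y_mem h t ω)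
  have hinner := r.integrable_inner_noise t (hWm.mono (ℱ.le t) le_rfl) hWb
  have hnoise := integrable_norm_sq (r.noise_memLp t)
  calc ∫ ω, ‖(g t ω).fst‖ ^ 2 ∂P
      ≤ ∫ ω, (L ^ 2 + ‖noise f x y g t ω‖ ^ 2 + 2 * ⟪noise f x y g t ω, W ω⟫) ∂P :=
        integral_mono (integrable_norm_sq (r.memLp_fst h t)) (by fun_prop) fun ω =>
          h.norm_fst_sq_le (x t ω) (r.y_mem h t ω) (g t ω)
    _ = L ^ 2 + ∫ ω, ‖noise f x y g t ω‖ ^ 2 ∂P := by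
        rw [integral_add (by fun_prop) (by fun_prop), integral_add (by fun_prop) hnoise,
          integral_const_mul, r.noise_orthogonal t W L hWm hWb]
        simp
    _ ≤ L ^ 2 + σ ^ 2 := by gcongr; exact r.noise_variance t

theorem integral_norm_fst_le (t : ℕ) : ∫ ω, L * ‖(g t ω).fst‖ ∂P ≤ L ^ 2 + σ ^ 2 := by
  have hnorm := r.integrable_norm_fst h t
  have hsq := integrable_norm_sq (r.memLp_fst h t)
  have hmean := r.integral_norm_fst_sq_le h t
  calc ∫ ω, L * ‖(g t ω).fst‖ ∂P
      ≤ ∫ ω, (L ^ 2 / 2 + ‖(g t ω).fst‖ ^ 2 / 2) ∂P :=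
        integral_mono (by fun_prop) (by fun_prop) fun ω => by
          linarith [two_mul_le_add_sq L ‖(g t ω).fst‖]
    _ = L ^ 2 / 2 + (∫ ω, ‖(g t ω).fst‖ ^ 2 ∂P) / 2 := by
        rw [integral_add (by fun_prop) (by fun_prop),
          integral_div (f := fun ω => ‖(g t ω).fst‖ ^ 2)]
        simp
    _ ≤ L ^ 2 + σ ^ 2 := by linarith [sq_nonneg σ]

theorem integral_norm_sub_le (hηx : 0 ≤ ηx) (s t : ℕ) :
    ∫ ω, L * ‖x (s + t) ω - x s ω‖ ∂P ≤ t * (ηx * (L ^ 2 + σ ^ 2)) := by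
  induction t with
  | zero => simp
  | succ t ih =>
    have hdist := r.integrable_norm_sub h s
    have hnorm := r.integrable_norm_fst h (s + t)
    have hstep (ω : Ω) : L * ‖x (s + (t + 1)) ω - x s ω‖ ≤
        L * ‖x (s + t) ω - x s ω‖ + ηx * (L * ‖(g (s + t) ω).fst‖) := by
      rw [← add_assoc, r.x_succ, sub_right_comm]
      have htri := norm_sub_le (x (s + t) ω - x s ω) (ηx • (g (s + t) ω).fst)
      rw [norm_smul, Real.norm_of_nonneg hηx] at htri
      linarith [mul_le_mul_of_nonneg_left htri h.L_pos.le]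
    calc ∫ ω, L * ‖x (s + (t + 1)) ω - x s ω‖ ∂P
        ≤ ∫ ω, (L * ‖x (s + t) ω - x s ω‖ + ηx * (L * ‖(g (s + t) ω).fst‖)) ∂P :=
          integral_mono ((hdist _).const_mul L)
            (((hdist _).const_mul L).add ((hnorm.const_mul L).const_mul ηx)) hstep
      _ = ∫ ω, L * ‖x (s + t) ω - x s ω‖ ∂P + ηx * ∫ ω, L * ‖(g (s + t) ω).fst‖ ∂P := by
          rw [integral_add ((hdist _).const_mul L) (by fun_prop), integral_const_mul ηx]
      _ ≤ t * (ηx * (L ^ 2 + σ ^ 2)) + ηx * (L ^ 2 + σ ^ 2) := by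
          gcongr
          exact r.integral_norm_fst_le h (s + t)
      _ = (t + 1 : ℕ) * (ηx * (L ^ 2 + σ ^ 2)) := by push_cast; ring

theorem integral_sub_le_integral_potential_sub (hηx : 0 ≤ ηx) (hηy : 0 < ηy)
    (hstep : ηy * ℓ ≤ 1 / 2 ∨ ηy * ℓ ≤ 1 ∧ σ = 0) {t : ℕ} {z : Ω → Vec n}
    (hz : Measurable[ℱ t] z) (hzY : ∀ ω, z ω ∈ Y) :
    ∫ ω, f (x t ω) (z ω) ∂P - ∫ ω, f (x t ω) (y t ω) ∂P ≤
      ∫ ω, potential f ηy (z ω) (x (t + 1) ω) (y (t + 1) ω) ∂P -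
      ∫ ω, potential f ηy (z ω) (x t ω) (y t ω) ∂P + ηx * (L ^ 2 + σ ^ 2) + ηy * σ ^ 2 := by
  have hzm : Measurable z := hz.mono (ℱ.le t) le_rfl
  set W : Ω → VecPair m n := fun ω => mkPair 0 (z ω - y t ω)
  have hWm : Measurable[ℱ t] W :=
    continuous_mkPair.measurable.comp (measurable_const.prodMk (hz.sub (r.y_measurable t)))
  have hWb (ω : Ω) : ‖W ω‖ ≤ D := by
    rw [norm_mkPair_zero_left]
    exact h.norm_sub_le (hzY ω) (r.y_mem h _ ω)
  have hinner := r.integrable_inner_noise t (hWm.mono (ℱ.le _) le_rfl) hWb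
  have hnoise := integrable_norm_sq (r.noise_memLp t)
  have hnorm := r.integrable_norm_fst h t
  have hpot := r.integrable_potential h hzm hzY t
  have hpot' := r.integrable_potential h hzm hzY (t + 1)
  have hmono := integral_mono_ae ((r.integrable_apply h hzm hzY t).sub (r.integrable_f h t))
    (by fun_prop) (r.ae_sub_le_potential_sub h hηx hηy hstep t hzY)
  simp only [Pi.sub_apply] at hmono
  rw [integral_sub (r.integrable_apply h hzm hzY t) (r.integrable_f h t),
    integral_sub (by fun_prop) hinner, integral_add (by fun_prop) (by fun_prop),
    integral_add (by fun_prop) (by fun_prop), integral_sub hpot' hpot,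
    integral_const_mul ηx, integral_const_mul ηy, r.noise_orthogonal t W D hWm hWb] at hmono
  have hdrift := mul_le_mul_of_nonneg_left (r.integral_norm_fst_le h t) hηx
  have hvar := mul_le_mul_of_nonneg_left (r.noise_variance t) hηy.le
  linarith

theorem integral_maxFun_le (hηx : 0 ≤ ηx) {s : ℕ} {z : Ω → Vec n} (hz : Measurable z)
    (hzY : ∀ ω, z ω ∈ Y) {δ : ℝ} (hδ : ∀ ω, maxFun f Y (x s ω) ≤ f (x s ω) (z ω) + δ) (t : ℕ) :
    ∫ ω, maxFun f Y (x (s + t) ω) ∂P ≤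
      ∫ ω, f (x (s + t) ω) (z ω) ∂P + δ + 2 * t * (ηx * (L ^ 2 + σ ^ 2)) := by
  have hdist := r.integrable_norm_sub h s (s + t)
  have happly := r.integrable_apply h hz hzY (s + t)
  have hupper := happly.fun_add (integrable_const δ)
  have hdrift (ω : Ω) : maxFun f Y (x (s + t) ω) ≤
      f (x (s + t) ω) (z ω) + δ + 2 * (L * ‖x (s + t) ω - x s ω‖) := by
    have hmax := h.lipschitzWith_maxFun.le_add_mul (x (s + t) ω) (x s ω)
    have hlip := (neg_le_abs _).trans (h.lipschitz _ (hzY ω) (x (s + t) ω) (x s ω))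
    rw [Real.coe_toNNReal L h.L_pos.le, dist_eq_norm] at hmax
    linarith [hδ ω]
  have hmono := integral_mono (r.integrable_maxFun h (s + t))
    (hupper.fun_add ((hdist.const_mul L).const_mul 2)) hdrift
  rw [integral_add hupper (by fun_prop), integral_add happly (by fun_prop),
    integral_const_mul 2, integral_const, probReal_univ, one_smul] at hmono
  linarith [r.integral_norm_sub_le h hηx s t]

theorem expectedGap_le (hηx : 0 ≤ ηx) (hηy : 0 < ηy)
    (hstep : ηy * ℓ ≤ 1 / 2 ∨ ηy * ℓ ≤ 1 ∧ σ = 0) {s : ℕ} {z : Ω → Vec n}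
    (hz : Measurable[ℱ s] z) (hzY : ∀ ω, z ω ∈ Y) {δ : ℝ}
    (hδ : ∀ ω, maxFun f Y (x s ω) ≤ f (x s ω) (z ω) + δ) (t : ℕ) :
    expectedGap f Y P x y (s + t) ≤ δ + (2 * t + 1) * (ηx * (L ^ 2 + σ ^ 2)) + ηy * σ ^ 2 +
      (∫ ω, potential f ηy (z ω) (x (s + t + 1) ω) (y (s + t + 1) ω) ∂P -
        ∫ ω, potential f ηy (z ω) (x (s + t) ω) (y (s + t) ω) ∂P) := by
  have hmax := r.integral_maxFun_le h hηx (hz.mono (ℱ.le s) le_rfl) hzY hδ t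
  have hascent := r.integral_sub_le_integral_potential_sub h hηx hηy hstep
    (hz.mono (ℱ.mono (Nat.le_add_right s t)) le_rfl) hzY
  rw [r.expectedGap_eq h]
  linarith

theorem sum_expectedGap_block_le (hηx : 0 ≤ ηx) (hηy : 0 < ηy)
    (hstep : ηy * ℓ ≤ 1 / 2 ∨ ηy * ℓ ≤ 1 ∧ σ = 0) {s : ℕ} {z : Ω → Vec n}
    (hz : Measurable[ℱ s] z) (hzY : ∀ ω, z ω ∈ Y) {δ : ℝ}
    (hδ : ∀ ω, maxFun f Y (x s ω) ≤ f (x s ω) (z ω) + δ) (b : ℕ) :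
    ∑ t ∈ Finset.range b, expectedGap f Y P x y (s + t) ≤
      b * δ + b ^ 2 * (ηx * (L ^ 2 + σ ^ 2)) + b * (ηy * σ ^ 2) +
      (∫ ω, f (x (s + b) ω) (y (s + b) ω) ∂P - ∫ ω, f (x s ω) (y s ω) ∂P) +
      (∫ ω, ‖z ω - y s ω‖ ^ 2 ∂P) / (2 * ηy) := by
  have hzm : Measurable z := hz.mono (ℱ.le s) le_rfl
  have hpot (t : ℕ) : ∫ ω, potential f ηy (z ω) (x t ω) (y t ω) ∂P =
      ∫ ω, f (x t ω) (y t ω) ∂P - (∫ ω, ‖z ω - y t ω‖ ^ 2 ∂P) / (2 * ηy) := by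
    rw [← integral_div]
    exact integral_sub (r.integrable_f h t) ((r.integrable_norm_sub_sq h hzm hzY t).div_const _)
  have htelescope : ∑ t ∈ Finset.range b, expectedGap f Y P x y (s + t) ≤
      b * δ + b ^ 2 * (ηx * (L ^ 2 + σ ^ 2)) + b * (ηy * σ ^ 2) +
      (∫ ω, potential f ηy (z ω) (x (s + b) ω) (y (s + b) ω) ∂P -
        ∫ ω, potential f ηy (z ω) (x s ω) (y s ω) ∂P) := by
    induction b with
    | zero => simp
    | succ b ih =>
      rw [Finset.sum_range_succ, ← add_assoc s b 1]
      have hgap := r.expectedGap_le h hηx hηy hstep hz hzY hδ b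
      push_cast
      linarith
  have hfinal : 0 ≤ (∫ ω, ‖z ω - y (s + b) ω‖ ^ 2 ∂P) / (2 * ηy) :=
    div_nonneg (integral_nonneg fun ω => sq_nonneg _) (by positivity)
  rw [hpot, hpot] at htelescope
  linarith

end IsNoisyRun

/-! ### The convergence rate -/

section StepSizes

/-- The number of iterations over which one near-maximizer is kept as comparison point: the
smallest `B` that makes the average initial distance term `D² / 2ηyB` at most `ε² / 64ℓ`. -/
def blockLength (ℓ D ε ηy : ℝ) : ℕ := ⌈32 * (ℓ * D ^ 2 / (ηy * ε ^ 2))⌉₊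

/-- Step sizes for which the averaged gradient norm is of order `ε²`. The factor `κ` is the
maximum in the iteration bound; it controls how small the step sizes are. -/
structure AdmissibleStepSizes (ℓ L D σ ε κ ηx ηy : ℝ) : Prop where
  x_pos : 0 < ηx
  y_pos : 0 < ηy
  y_le : ηy * ℓ ≤ 1 / 2 ∨ ηy * ℓ ≤ 1 ∧ σ = 0
  drift_le : ℓ * (ηx * (L ^ 2 + σ ^ 2)) ≤ ε ^ 2 / 80
  block_drift_le : ℓ ^ 2 * D ^ 2 * (ηx * (L ^ 2 + σ ^ 2)) ≤ ηy * ε ^ 4 / 4096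
  noise_le : ℓ * (ηy * σ ^ 2) ≤ ε ^ 2 / 32
  one_le : 1 ≤ κ
  inv_x_le : 1 / ηx ≤ 131072 * (ℓ * (L ^ 2 + σ ^ 2) / ε ^ 2) * κ
  inv_y_le : ℓ * D ^ 2 / (ηy * ε ^ 2) ≤ 32 * κ

variable {ℓ L D σ ε κ ηx ηy : ℝ}

theorem blockLength_pos (hℓ : 0 < ℓ) (hD : 0 < D) (hε : 0 < ε) (hηy : 0 < ηy) :
    0 < blockLength ℓ D ε ηy :=
  Nat.ceil_pos.2 (by positivity)

theorem blockLength_le (hℓ : 0 < ℓ) (hηy : 0 < ηy) :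
    (blockLength ℓ D ε ηy : ℝ) ≤ 32 * (ℓ * D ^ 2 / (ηy * ε ^ 2)) + 1 :=
  (Nat.ceil_lt_add_one (by positivity)).le

theorem div_blockLength_le (hℓ : 0 < ℓ) (hD : 0 < D) (hε : 0 < ε) (hηy : 0 < ηy) :
    4 * ℓ * (D ^ 2 / (2 * ηy) / blockLength ℓ D ε ηy) ≤ ε ^ 2 / 16 := by
  have hle : 32 * (ℓ * D ^ 2 / (ηy * ε ^ 2)) ≤ blockLength ℓ D ε ηy := Nat.le_ceil _
  calc 4 * ℓ * (D ^ 2 / (2 * ηy) / blockLength ℓ D ε ηy)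
      ≤ 4 * ℓ * (D ^ 2 / (2 * ηy) / (32 * (ℓ * D ^ 2 / (ηy * ε ^ 2)))) := by gcongr
    _ = ε ^ 2 / 16 := by field_simp; norm_num

namespace AdmissibleStepSizes

variable (hη : AdmissibleStepSizes ℓ L D σ ε κ ηx ηy)
include hη

theorem blockLength_mul_drift_le (hℓ : 0 < ℓ) (hε : 0 < ε) :
    4 * ℓ * (blockLength ℓ D ε ηy * (ηx * (L ^ 2 + σ ^ 2))) ≤ ε ^ 2 / 20 + ε ^ 2 / 32 := by
  have hηx := hη.x_pos
  have hηy := hη.y_pos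
  have hblock : 32 * (ℓ ^ 2 * D ^ 2 * (ηx * (L ^ 2 + σ ^ 2)) / (ηy * ε ^ 2)) ≤ ε ^ 2 / 128 := by
    rw [← le_div_iff₀' (by norm_num), div_le_iff₀ (by positivity)]
    linear_combination hη.block_drift_le
  calc 4 * ℓ * (blockLength ℓ D ε ηy * (ηx * (L ^ 2 + σ ^ 2)))
      ≤ 4 * ℓ * ((32 * (ℓ * D ^ 2 / (ηy * ε ^ 2)) + 1) * (ηx * (L ^ 2 + σ ^ 2))) := by
        gcongr
        exact blockLength_le hℓ hηy
    _ = 4 * (32 * (ℓ ^ 2 * D ^ 2 * (ηx * (L ^ 2 + σ ^ 2)) / (ηy * ε ^ 2))) +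
        4 * (ℓ * (ηx * (L ^ 2 + σ ^ 2))) := by ring
    _ ≤ ε ^ 2 / 20 + ε ^ 2 / 32 := by linarith [hη.drift_le]

theorem error_le (hℓ : 0 < ℓ) (hD : 0 < D) (hε : 0 < ε) :
    4 * ℓ * (ε ^ 2 / (40 * ℓ) + (blockLength ℓ D ε ηy + 1) * (ηx * (L ^ 2 + σ ^ 2)) +
      ηy * σ ^ 2 + D ^ 2 / (2 * ηy) / blockLength ℓ D ε ηy) +
      2 * (ℓ * (ηx * (L ^ 2 + σ ^ 2))) ≤ ε ^ 2 / 2 := by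
  have hbias : 4 * ℓ * (ε ^ 2 / (40 * ℓ)) = ε ^ 2 / 10 := by field_simp; norm_num
  have hdrift := hη.blockLength_mul_drift_le hℓ hε
  have hdist := div_blockLength_le hℓ hD hε hη.y_pos
  linarith [hη.drift_le, hη.noise_le, sq_nonneg ε]

theorem initial_cost_le (hℓ : 0 < ℓ) (hε : 0 < ε) {ΔΦ Δ₀ : ℝ} (hΔΦ : 0 ≤ ΔΦ) (hΔ₀ : 0 ≤ Δ₀) :
    2 * ΔΦ / ηx + 4 * ℓ * (blockLength ℓ D ε ηy * Δ₀) ≤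
      524288 * ((ℓ * (L ^ 2 + σ ^ 2) * ΔΦ / ε ^ 4 + ℓ * Δ₀ / ε ^ 2) * κ) * ε ^ 2 := by
  have hκ : 0 ≤ κ := zero_le_one.trans hη.one_le
  have hx : 2 * ΔΦ / ηx ≤ 262144 * (ℓ * (L ^ 2 + σ ^ 2) * ΔΦ / ε ^ 2 * κ) :=
    calc 2 * ΔΦ / ηx = 2 * ΔΦ * (1 / ηx) := by ring
      _ ≤ 2 * ΔΦ * (131072 * (ℓ * (L ^ 2 + σ ^ 2) / ε ^ 2) * κ) := by
          gcongr
          exact hη.inv_x_le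
      _ = 262144 * (ℓ * (L ^ 2 + σ ^ 2) * ΔΦ / ε ^ 2 * κ) := by ring
  have hB : (blockLength ℓ D ε ηy : ℝ) ≤ 1025 * κ := by
    linarith [blockLength_le (D := D) (ε := ε) hℓ hη.y_pos, hη.inv_y_le, hη.one_le]
  have hy : 4 * ℓ * (blockLength ℓ D ε ηy * Δ₀) ≤ 4100 * (ℓ * Δ₀ * κ) :=
    calc 4 * ℓ * (blockLength ℓ D ε ηy * Δ₀) ≤ 4 * ℓ * (1025 * κ * Δ₀) := by gcongr
      _ = 4100 * (ℓ * Δ₀ * κ) := by ring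
  calc 2 * ΔΦ / ηx + 4 * ℓ * (blockLength ℓ D ε ηy * Δ₀)
      ≤ 524288 * (ℓ * (L ^ 2 + σ ^ 2) * ΔΦ / ε ^ 2 * κ) + 524288 * (ℓ * Δ₀ * κ) := by
        have hx₀ : 0 ≤ ℓ * (L ^ 2 + σ ^ 2) * ΔΦ / ε ^ 2 * κ := by positivity
        have hy₀ : 0 ≤ ℓ * Δ₀ * κ := by positivity
        linarith
    _ = 524288 * ((ℓ * (L ^ 2 + σ ^ 2) * ΔΦ / ε ^ 4 + ℓ * Δ₀ / ε ^ 2) * κ) * ε ^ 2 := by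
        field_simp

end AdmissibleStepSizes

end StepSizes

theorem SmoothNonconvexConcave.exists_measurable_approx_maximizer {m n : ℕ}
    {f : Vec m → Vec n → ℝ} {Y : Set (Vec n)} {ℓ L D : ℝ}
    (h : SmoothNonconvexConcave f Y ℓ L D) {δ : ℝ} (hδ : 0 < δ) :
    ∃ z : Vec m → Vec n, Measurable z ∧ (∀ x, z x ∈ Y) ∧
      ∀ x, maxFun f Y x ≤ f x (z x) + δ := by
  classical
  have : Nonempty Y := h.nonempty.to_subtype
  set d : ℕ → Y := TopologicalSpace.denseSeq Y
  have hex (x : Vec m) : ∃ k, maxFun f Y x < f x (d k) + δ := by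
    have hopen : IsOpen {y : Y | maxFun f Y x < f x y + δ} :=
      isOpen_lt continuous_const
        (((isSmooth_right h.smooth x).continuous.comp continuous_subtype_val).add continuous_const)
    obtain ⟨y, hy, hxy⟩ := h.exists_eq_maxFun x
    exact (TopologicalSpace.denseRange_denseSeq Y).exists_mem_open hopen
      ⟨⟨y, hy⟩, by simp [hxy, hδ]⟩
  refine ⟨fun x => d (Nat.find (hex x)), ?_, fun x => (d _).2, fun x => (Nat.find_spec (hex x)).le⟩
  exact Measurable.find (f := fun k (_ : Vec m) => (d k : Vec n)) (fun k => measurable_const)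
    (fun k => measurableSet_lt h.lipschitzWith_maxFun.continuous.measurable
      ((isSmooth_left h.smooth (d k : Vec n)).continuous.measurable.add_const δ)) hex

/-- The mean square `𝔼 ‖∇Φ_{1/2ℓ}(x t)‖²` of the gradient of the Moreau envelope. -/
def meanSqGrad {m n : ℕ} {Ω : Type*} [MeasurableSpace Ω] (f : Vec m → Vec n → ℝ)
    (Y : Set (Vec n)) (ℓ : ℝ) (P : Measure Ω) (x : ℕ → Ω → Vec m) (t : ℕ) : ℝ :=
  ∫ ω, ‖gradient (envelope f Y ℓ) (x t ω)‖ ^ 2 ∂P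

namespace IsNoisyRun

variable {m n : ℕ} {f : Vec m → Vec n → ℝ} {Y : Set (Vec n)} {ℓ L D ηx ηy σ : ℝ}
  {x₀ : Vec m} {y₀ : Vec n} {Ω : Type*} {mΩ : MeasurableSpace Ω} {P : Measure Ω}
  [IsProbabilityMeasure P] {ℱ : Filtration ℕ mΩ} {x : ℕ → Ω → Vec m} {y : ℕ → Ω → Vec n}
  {g : ℕ → Ω → VecPair m n}
  (r : IsNoisyRun f Y ηx ηy σ x₀ y₀ P ℱ x y g) (h : SmoothNonconvexConcave f Y ℓ L D)
include r h

theorem integral_f_le (hηx : 0 ≤ ηx) (t : ℕ) :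
    ∫ ω, f (x t ω) (y t ω) ∂P ≤ maxFun f Y x₀ + t * (ηx * (L ^ 2 + σ ^ 2)) := by
  have hdist := (r.integrable_norm_sub h 0 t).const_mul L
  have hdrift (ω : Ω) : f (x t ω) (y t ω) ≤ maxFun f Y x₀ + L * ‖x t ω - x 0 ω‖ := by
    have hlip := h.lipschitzWith_maxFun.le_add_mul (x t ω) (x 0 ω)
    rw [Real.coe_toNNReal L h.L_pos.le, dist_eq_norm] at hlip
    exact (h.le_maxFun _ (r.y_mem h t ω)).trans (r.x_zero ω ▸ hlip)
  have hmono := integral_mono (r.integrable_f h t) (by fun_prop) hdrift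
  rw [integral_add (by fun_prop) hdist, integral_const, probReal_univ, one_smul] at hmono
  have hmean := r.integral_norm_sub_le h hηx 0 t
  rw [zero_add] at hmean
  linarith

section Gap

variable (hηx : 0 ≤ ηx) (hηy : 0 < ηy) (hstep : ηy * ℓ ≤ 1 / 2 ∨ ηy * ℓ ≤ 1 ∧ σ = 0)
include hηx hηy hstep

/- Comparing with `y₀` itself makes the initial distance vanish, so that the first block pays only
for the initial gap. -/
theorem sum_expectedGap_first_block_le (b : ℕ) :
    ∑ t ∈ Finset.range b, expectedGap f Y P x y t ≤
      b * (maxFun f Y x₀ - f x₀ y₀) + b ^ 2 * (ηx * (L ^ 2 + σ ^ 2)) + b * (ηy * σ ^ 2) +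
      (∫ ω, f (x b ω) (y b ω) ∂P - f x₀ y₀) := by
  have hblock := r.sum_expectedGap_block_le h hηx hηy hstep (s := 0) (z := fun _ => y₀)
    (δ := maxFun f Y x₀ - f x₀ y₀) measurable_const (fun _ => r.start_mem)
    (fun ω => by rw [r.x_zero]; linarith) b
  simpa only [zero_add, r.x_zero, r.y_zero, sub_self, norm_zero, ne_eq, OfNat.ofNat_ne_zero,
    not_false_eq_true, zero_pow, integral_const, probReal_univ, one_smul, zero_div, smul_zero,
    add_zero] using hblock

theorem sum_expectedGap_next_block_le {δ : ℝ} (hδ : 0 < δ) (s B : ℕ) :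
    ∑ t ∈ Finset.range B, expectedGap f Y P x y (s + t) ≤
      B * δ + B ^ 2 * (ηx * (L ^ 2 + σ ^ 2)) + B * (ηy * σ ^ 2) +
      (∫ ω, f (x (s + B) ω) (y (s + B) ω) ∂P - ∫ ω, f (x s ω) (y s ω) ∂P) +
      D ^ 2 / (2 * ηy) := by
  obtain ⟨z, hzm, hzY, hz⟩ := h.exists_measurable_approx_maximizer hδ
  have hblock := r.sum_expectedGap_block_le h hηx hηy hstep (z := fun ω => z (x s ω))
    (hzm.comp (r.x_measurable s)) (fun ω => hzY _) (fun ω => hz _) B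
  have hdist : ∫ ω, ‖z (x s ω) - y s ω‖ ^ 2 ∂P ≤ D ^ 2 := by
    simpa using integral_mono
      (r.integrable_norm_sub_sq h (hzm.comp (r.measurable_x s)) (fun ω => hzY _) s)
      (integrable_const (μ := P) (D ^ 2)) fun ω =>
        pow_le_pow_left₀ (norm_nonneg _) (h.norm_sub_le (hzY _) (r.y_mem h s ω)) 2
  have hdiv := div_le_div_of_nonneg_right hdist (by positivity : 0 ≤ 2 * ηy)
  linarith

theorem sum_expectedGap_blocks_le {δ : ℝ} (hδ : 0 < δ) (b B q : ℕ) :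
    ∑ t ∈ Finset.range (b + q * B), expectedGap f Y P x y t ≤
      b * (maxFun f Y x₀ - f x₀ y₀) + q * B * δ +
      (b ^ 2 + q * B ^ 2) * (ηx * (L ^ 2 + σ ^ 2)) + (b + q * B) * (ηy * σ ^ 2) +
      (∫ ω, f (x (b + q * B) ω) (y (b + q * B) ω) ∂P - f x₀ y₀) + q * (D ^ 2 / (2 * ηy)) := by
  induction q with
  | zero =>
    have hfirst := r.sum_expectedGap_first_block_le h hηx hηy hstep b
    simp only [Nat.cast_zero, zero_mul, add_zero]
    linarith
  | succ q ih =>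
    have hnext := r.sum_expectedGap_next_block_le h hηx hηy hstep hδ (b + q * B) B
    rw [add_mul q 1 B, one_mul, ← add_assoc b (q * B) B, Finset.sum_range_add]
    push_cast
    linarith

theorem sum_expectedGap_le {δ : ℝ} (hδ : 0 < δ) {B : ℕ} (hB : 0 < B) (T : ℕ) :
    ∑ t ∈ Finset.range T, expectedGap f Y P x y t ≤
      B * (maxFun f Y x₀ - f x₀ y₀) + T * (δ + (B + 1) * (ηx * (L ^ 2 + σ ^ 2)) +
        ηy * σ ^ 2 + D ^ 2 / (2 * ηy) / B) := by
  have hT : T % B + T / B * B = T := by rw [mul_comm]; exact Nat.mod_add_div T B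
  have hblocks := r.sum_expectedGap_blocks_le h hηx hηy hstep hδ (T % B) B (T / B)
  rw [hT] at hblocks
  have hend := r.integral_f_le h hηx T
  have hlt : ((T % B : ℕ) : ℝ) + 1 ≤ B := by exact_mod_cast Nat.mod_lt T hB
  have hTr : ((T % B : ℕ) : ℝ) + ((T / B : ℕ) : ℝ) * B = T := by exact_mod_cast hT
  have hb : (0 : ℝ) ≤ ((T % B : ℕ) : ℝ) := Nat.cast_nonneg _
  have hBpos : (0 : ℝ) < B := by exact_mod_cast hB
  generalize ((T % B : ℕ) : ℝ) = b at *
  generalize ((T / B : ℕ) : ℝ) = q at *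
  have hqB : q * B ≤ T := by linarith
  have hgap : (b + 1) * (maxFun f Y x₀ - f x₀ y₀) ≤ B * (maxFun f Y x₀ - f x₀ y₀) :=
    mul_le_mul_of_nonneg_right hlt (sub_nonneg.2 (h.le_maxFun x₀ r.start_mem))
  have hbias : q * B * δ ≤ T * δ := by gcongr
  have hdrift : (b ^ 2 + q * B ^ 2) * (ηx * (L ^ 2 + σ ^ 2)) ≤
      T * B * (ηx * (L ^ 2 + σ ^ 2)) := by
    refine mul_le_mul_of_nonneg_right ?_ (by positivity)
    calc b ^ 2 + q * B ^ 2 = b * b + q * B * B := by ring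
      _ ≤ b * B + q * B * B := by gcongr; linarith
      _ = T * B := by rw [← hTr]; ring
  have hdist : q * (D ^ 2 / (2 * ηy)) ≤ T * (D ^ 2 / (2 * ηy) / B) := by
    calc q * (D ^ 2 / (2 * ηy)) = q * B * (D ^ 2 / (2 * ηy) / B) := by
          rw [mul_assoc, mul_div_cancel₀ _ hBpos.ne']
      _ ≤ T * (D ^ 2 / (2 * ηy) / B) := by gcongr
  rw [hTr] at hblocks
  linarith

end Gap

section Envelope

variable {p : Vec m → Vec m} (hp : ∀ x, IsProx ℓ (maxFun f Y) x (p x))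
include hp

theorem integrable_norm_gradient_sq (t : ℕ) :
    Integrable (fun ω => ‖gradient (envelope f Y ℓ) (x t ω)‖ ^ 2) P :=
  .of_bound (((h.continuous_norm_gradient_envelope hp).pow 2).measurable.comp
    (r.measurable_x t)).aestronglyMeasurable ((2 * L) ^ 2) (.of_forall fun ω => by
      rw [norm_pow, norm_norm]
      gcongr
      exact h.norm_gradient_envelope_le hp _)

variable (hbdd : BddBelow (Set.range (maxFun f Y)))
include hbdd

theorem integrable_envelope (t : ℕ) : Integrable (fun ω => envelope f Y ℓ (x t ω)) P :=
  integrable_of_le_of_le ((differentiable_moreauEnvelope hp h.ell_pos).continuous.measurable.comp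
      (r.measurable_x t)).aestronglyMeasurable
    (.of_forall fun ω => (hp (x t ω)).iInf_le_moreauEnvelope h.ell_pos hbdd)
    (.of_forall fun ω => (hp (x t ω)).moreauEnvelope_le_self h.ell_pos)
    (integrable_const _) (r.integrable_maxFun h t)

theorem integral_envelope_succ_le (hηx : 0 ≤ ηx) (t : ℕ) :
    ∫ ω, envelope f Y ℓ (x (t + 1) ω) ∂P ≤
      ∫ ω, envelope f Y ℓ (x t ω) ∂P + 2 * ηx * ℓ * expectedGap f Y P x y t -
      ηx / 2 * meanSqGrad f Y ℓ P x t + ηx ^ 2 * ℓ * (L ^ 2 + σ ^ 2) := by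
  set W : Ω → VecPair m n := fun ω => mkPair (p (x t ω) - x t ω) 0
  have hWm : Measurable[ℱ t] W := continuous_mkPair.measurable.comp
    ((((continuous_prox hp h.ell_pos).sub continuous_id).measurable.comp
      (r.x_measurable t)).prodMk measurable_const)
  have hWb (ω : Ω) : ‖W ω‖ ≤ L / ℓ := by
    rw [norm_mkPair_zero_right]
    exact h.norm_prox_sub_le hp _
  have hinner := r.integrable_inner_noise t (hWm.mono (ℱ.le t) le_rfl) hWb
  have hsq := integrable_norm_sq (r.memLp_fst h t)
  have hgrad := r.integrable_norm_gradient_sq h hp t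
  have henv := r.integrable_envelope h hp hbdd t
  have henv' := r.integrable_envelope h hp hbdd (t + 1)
  have hgap : Integrable (fun ω => maxFun f Y (x t ω) - f (x t ω) (y t ω)) P :=
    (r.integrable_maxFun h t).sub (r.integrable_f h t)
  have hdescent (ω : Ω) :
      envelope f Y ℓ (x (t + 1) ω) + ηx / 2 * ‖gradient (envelope f Y ℓ) (x t ω)‖ ^ 2 ≤
        envelope f Y ℓ (x t ω) + 2 * ηx * ℓ * (maxFun f Y (x t ω) - f (x t ω) (y t ω)) +
        2 * ηx * ℓ * ⟪noise f x y g t ω, W ω⟫ + ηx ^ 2 * ℓ * ‖(g t ω).fst‖ ^ 2 := by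
    have hstep := h.envelope_step_le hp (x t ω) (r.y_mem h t ω) (g t ω) hηx
    rw [r.x_succ, noise]
    linarith
  have hdrift := henv.fun_add (hgap.const_mul (2 * ηx * ℓ))
  have hnoisy := hdrift.fun_add (hinner.const_mul (2 * ηx * ℓ))
  have hmono := integral_mono (henv'.fun_add (hgrad.const_mul (ηx / 2)))
    (hnoisy.fun_add (hsq.const_mul (ηx ^ 2 * ℓ))) hdescent
  rw [integral_add henv' (hgrad.const_mul _), integral_add hnoisy (hsq.const_mul _),
    integral_add hdrift (hinner.const_mul _), integral_add henv (hgap.const_mul _),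
    integral_const_mul, integral_const_mul, integral_const_mul, integral_const_mul,
    r.noise_orthogonal t W _ hWm hWb] at hmono
  have hℓ := h.ell_pos
  have hmean := mul_le_mul_of_nonneg_left (r.integral_norm_fst_sq_le h t)
    (by positivity : 0 ≤ ηx ^ 2 * ℓ)
  rw [expectedGap, meanSqGrad]
  linarith

theorem sum_meanSqGrad_le (hηx : 0 < ηx) (T : ℕ) :
    ∑ t ∈ Finset.range T, meanSqGrad f Y ℓ P x t ≤
      2 * (maxFun f Y x₀ - ⨅ w, maxFun f Y w) / ηx +
      4 * ℓ * ∑ t ∈ Finset.range T, expectedGap f Y P x y t +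
      T * (2 * (ℓ * (ηx * (L ^ 2 + σ ^ 2)))) := by
  have htelescope : ηx / 2 * ∑ t ∈ Finset.range T, meanSqGrad f Y ℓ P x t ≤
      maxFun f Y x₀ - ∫ ω, envelope f Y ℓ (x T ω) ∂P +
      2 * ηx * ℓ * ∑ t ∈ Finset.range T, expectedGap f Y P x y t +
      T * (ηx ^ 2 * ℓ * (L ^ 2 + σ ^ 2)) := by
    induction T with
    | zero =>
      have hstart := (hp x₀).moreauEnvelope_le_self h.ell_pos
      simpa only [r.x_zero, Finset.sum_range_zero, integral_const, probReal_univ, one_smul,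
        mul_zero, Nat.cast_zero, zero_mul, add_zero, sub_nonneg] using hstart
    | succ T ih =>
      have hdescent := r.integral_envelope_succ_le h hp hbdd hηx.le T
      rw [Finset.sum_range_succ, Finset.sum_range_succ]
      push_cast
      linarith
  have hinf : ⨅ w, maxFun f Y w ≤ ∫ ω, envelope f Y ℓ (x T ω) ∂P := by
    simpa using integral_mono (integrable_const (μ := P) (⨅ w, maxFun f Y w))
      (r.integrable_envelope h hp hbdd T)
      fun ω => (hp (x T ω)).iInf_le_moreauEnvelope h.ell_pos hbdd
  have hdiv : 2 * (maxFun f Y x₀ - ⨅ w, maxFun f Y w) / ηx * ηx =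
    2 * (maxFun f Y x₀ - ⨅ w, maxFun f Y w) := div_mul_cancel₀ _ hηx.ne'
  refine le_of_mul_le_mul_right ?_ hηx
  rw [add_mul, add_mul, hdiv]
  linarith

theorem sum_meanSqGrad_le_mul_sq {ε κ : ℝ} (hε : 0 < ε)
    (hη : AdmissibleStepSizes ℓ L D σ ε κ ηx ηy) {T : ℕ}
    (hT : 1048576 * ((ℓ * (L ^ 2 + σ ^ 2) * (maxFun f Y x₀ - ⨅ w, maxFun f Y w) / ε ^ 4 +
      ℓ * (maxFun f Y x₀ - f x₀ y₀) / ε ^ 2) * κ) ≤ T) :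
    ∑ t ∈ Finset.range T, meanSqGrad f Y ℓ P x t ≤ T * ε ^ 2 := by
  have hℓ := h.ell_pos
  have hgrad := r.sum_meanSqGrad_le h hp hbdd hη.x_pos T
  have hgap := mul_le_mul_of_nonneg_left (r.sum_expectedGap_le h hη.x_pos.le hη.y_pos hη.y_le
    (δ := ε ^ 2 / (40 * ℓ)) (by positivity) (blockLength_pos hℓ h.D_pos hε hη.y_pos) T)
    (by positivity : 0 ≤ 4 * ℓ)
  have herror := mul_le_mul_of_nonneg_left (hη.error_le hℓ h.D_pos hε) (Nat.cast_nonneg T)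
  have hcost := hη.initial_cost_le hℓ hε (sub_nonneg.2 (ciInf_le hbdd x₀))
    (sub_nonneg.2 (h.le_maxFun x₀ r.start_mem))
  have hT' := mul_le_mul_of_nonneg_right hT (sq_nonneg ε)
  linarith

end Envelope

end IsNoisyRun

/-! ### Sampling -/

section FreshSample

variable {Ω α β : Type*} {mΩ : MeasurableSpace Ω} [MeasurableSpace α] [MeasurableSpace β]
  {P : Measure Ω} [IsFiniteMeasure P] {U : Ω → α} {S : Ω → β}

theorem lintegral_comp_prodMk_of_indepFun (hU : Measurable U) (hS : Measurable S)
    (hind : IndepFun U S P) {F : α × β → ENNReal} (hF : Measurable F) :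
    ∫⁻ ω, F (U ω, S ω) ∂P = ∫⁻ ω, ∫⁻ s, F (U ω, s) ∂P.map S ∂P := by
  rw [← lintegral_map hF (hU.prodMk hS),
    (indepFun_iff_map_prod_eq_prod_map_map hU.aemeasurable hS.aemeasurable).1 hind,
    lintegral_prod _ hF.aemeasurable, lintegral_map hF.lintegral_prod_right' hU]

theorem integral_comp_prodMk_of_indepFun (hU : Measurable U) (hS : Measurable S)
    (hind : IndepFun U S P) {E : Type*} [NormedAddCommGroup E] [NormedSpace ℝ E] {F : α × β → E}
    (hF : StronglyMeasurable F) (hint : Integrable (fun ω => F (U ω, S ω)) P) :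
    ∫ ω, F (U ω, S ω) ∂P = ∫ ω, ∫ s, F (U ω, s) ∂P.map S ∂P := by
  have hpair := (hU.prodMk hS).aemeasurable (μ := P)
  have hint' := (integrable_map_measure hF.aestronglyMeasurable hpair).2 hint
  have hmap := (indepFun_iff_map_prod_eq_prod_map_map hU.aemeasurable hS.aemeasurable).1 hind
  rw [← integral_map hpair hF.aestronglyMeasurable, hmap, integral_prod _ (hmap ▸ hint'),
    integral_map hU.aemeasurable hF.integral_prod_right'.aestronglyMeasurable]

end FreshSample

/-- The `σ`-algebras generated by the samples of the first `t` iterations. -/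
def sampleFiltration {Ω Ξ : Type*} {mΩ : MeasurableSpace Ω} [MeasurableSpace Ξ] {M : ℕ}
    {ξ : ℕ → Fin M → Ω → Ξ} (hξ : ∀ t i, Measurable (ξ t i)) : Filtration ℕ mΩ where
  seq t := ⨆ p ∈ {p : ℕ × Fin M | p.1 < t}, MeasurableSpace.comap (ξ p.1 p.2) inferInstance
  mono' _ _ hst := biSup_mono fun _ hp => lt_of_lt_of_le hp hst
  le' _ := iSup₂_le fun p _ => (hξ p.1 p.2).comap_le

theorem measurable_sampleFiltration {Ω Ξ : Type*} [MeasurableSpace Ω] [MeasurableSpace Ξ]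
    {M : ℕ} {ξ : ℕ → Fin M → Ω → Ξ} (hξ : ∀ t i, Measurable (ξ t i)) {s t : ℕ} (hst : s < t)
    (i : Fin M) : Measurable[sampleFiltration hξ t] (ξ s i) :=
  measurable_iff_comap_le.2 <| le_iSup₂_of_le
    (f := fun (p : ℕ × Fin M) (_ : p ∈ {p : ℕ × Fin M | p.1 < t}) =>
      MeasurableSpace.comap (ξ p.1 p.2) inferInstance) (s, i) hst le_rfl

theorem IsSampling.indepFun {Ω Ξ α : Type*} [MeasurableSpace Ω] [MeasurableSpace Ξ]
    [MeasurableSpace α] {M : ℕ} {P : Measure Ω} {ν : Measure Ξ} {ξ : ℕ → Fin M → Ω → Ξ}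
    (hξ : IsSampling P ν ξ) {t : ℕ} {U : Ω → α}
    (hU : Measurable[sampleFiltration hξ.measurable t] U) (i : Fin M) :
    IndepFun U (ξ t i) P := by
  have hpast := indep_iSup_of_disjoint
    (m := fun p : ℕ × Fin M => MeasurableSpace.comap (ξ p.1 p.2) inferInstance)
    (fun p => (hξ.measurable p.1 p.2).comap_le) hξ.indep
    (S := {p | p.1 < t}) (T := {(t, i)}) (by simp)
  rw [IndepFun_iff_Indep]
  simpa using indep_of_indep_of_le_left hpast hU.comap_le

namespace IsStochasticGradient

variable {m n : ℕ} {Ξ : Type*} [MeasurableSpace Ξ] {f : Vec m → Vec n → ℝ} {Y : Set (Vec n)}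
  {G : Vec m → Vec n → Ξ → VecPair m n} {ν : Measure Ξ} {σ : ℝ}
  (hG : IsStochasticGradient f Y G ν σ)
include hG

theorem memLp_error (x : Vec m) {y : Vec n} (hy : y ∈ Y) :
    MemLp (fun s => G x y s - grad f x y) 2 ν :=
  have := hG.isProbabilityMeasure
  (hG.square_integrable x y hy).sub (memLp_const (grad f x y))

theorem lintegral_norm_sq_error_le (x : Vec m) {y : Vec n} (hy : y ∈ Y) :
    ∫⁻ s, ENNReal.ofReal (‖G x y s - grad f x y‖ ^ 2) ∂ν ≤ ENNReal.ofReal (σ ^ 2) := by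
  rw [← ofReal_integral_eq_lintegral_ofReal (integrable_norm_sq (hG.memLp_error x hy))
    (.of_forall fun _ => sq_nonneg _)]
  refine ENNReal.ofReal_le_ofReal ?_
  simpa only [hG.unbiased x y hy] using hG.variance_le x y hy

theorem integral_inner_error (x : Vec m) {y : Vec n} (hy : y ∈ Y) (w : VecPair m n) :
    ∫ s, ⟪G x y s - grad f x y, w⟫ ∂ν = 0 := by
  have := hG.isProbabilityMeasure
  have hint := (hG.square_integrable x y hy).integrable one_le_two
  simp_rw [real_inner_comm w]
  rw [integral_inner ((hG.memLp_error x hy).integrable one_le_two),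
    integral_sub hint (integrable_const _), hG.unbiased x y hy, integral_const, probReal_univ,
    one_smul, sub_self, inner_zero_right]

variable {ℓ : ℝ} (hf : IsSmooth ℓ (joint f))
include hf

theorem measurable_error : Measurable fun q : (Vec m × Vec n) × Ξ =>
    G q.1.1 q.1.2 q.2 - grad f q.1.1 q.1.2 :=
  (hG.measurable.comp (measurable_fst.fst.prodMk (measurable_fst.snd.prodMk measurable_snd))).sub
    ((continuous_grad hf).measurable.comp measurable_fst)

variable {Ω : Type*} {mΩ : MeasurableSpace Ω} {P : Measure Ω} [IsProbabilityMeasure P]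
  {X : Ω → Vec m} {V : Ω → Vec n} {S : Ω → Ξ} (hVY : ∀ ω, V ω ∈ Y) (hS : Measurable S)
  (hν : P.map S = ν)
include hVY hS hν

section Moments

variable (hXV : Measurable fun ω => (X ω, V ω))
  (hind : IndepFun (fun ω => (X ω, V ω)) S P)
include hXV hind

theorem lintegral_norm_sq_error_sample_le :
    ∫⁻ ω, ENNReal.ofReal (‖G (X ω) (V ω) (S ω) - grad f (X ω) (V ω)‖ ^ 2) ∂P ≤
      ENNReal.ofReal (σ ^ 2) := by
  rw [lintegral_comp_prodMk_of_indepFun hXV hS hind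
    (F := fun q => ENNReal.ofReal (‖G q.1.1 q.1.2 q.2 - grad f q.1.1 q.1.2‖ ^ 2))
    ((hG.measurable_error hf).norm.pow_const 2).ennreal_ofReal, hν]
  calc ∫⁻ ω, ∫⁻ s, ENNReal.ofReal (‖G (X ω) (V ω) s - grad f (X ω) (V ω)‖ ^ 2) ∂ν ∂P
      ≤ ∫⁻ _, ENNReal.ofReal (σ ^ 2) ∂P :=
        lintegral_mono fun ω => hG.lintegral_norm_sq_error_le (X ω) (hVY ω)
    _ = ENNReal.ofReal (σ ^ 2) := by rw [lintegral_const, measure_univ, mul_one]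

theorem memLp_error_sample : MemLp (fun ω => G (X ω) (V ω) (S ω) - grad f (X ω) (V ω)) 2 P := by
  have hmeas := (hG.measurable_error hf).comp (hXV.prodMk hS)
  refine (memLp_two_iff_integrable_sq_norm hmeas.aestronglyMeasurable).2
    ⟨(hmeas.norm.pow_const 2).aestronglyMeasurable, ?_⟩
  rw [hasFiniteIntegral_iff_ofReal (.of_forall fun _ => sq_nonneg _)]
  exact (hG.lintegral_norm_sq_error_sample_le hf hVY hS hν hXV hind).trans_lt
    ENNReal.ofReal_lt_top

theorem integral_norm_sq_error_sample_le :
    ∫ ω, ‖G (X ω) (V ω) (S ω) - grad f (X ω) (V ω)‖ ^ 2 ∂P ≤ σ ^ 2 := by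
  have hle := hG.lintegral_norm_sq_error_sample_le hf hVY hS hν hXV hind
  rwa [← ofReal_integral_eq_lintegral_ofReal
    (integrable_norm_sq (hG.memLp_error_sample hf hVY hS hν hXV hind))
    (.of_forall fun _ => sq_nonneg _), ENNReal.ofReal_le_ofReal_iff (sq_nonneg σ)] at hle

end Moments

theorem integral_inner_error_sample {W : Ω → VecPair m n} {C : ℝ}
    (hXVW : Measurable fun ω => ((X ω, V ω), W ω))
    (hind : IndepFun (fun ω => ((X ω, V ω), W ω)) S P)
    (hW : ∀ ω, ‖W ω‖ ≤ C) : ∫ ω, ⟪G (X ω) (V ω) (S ω) - grad f (X ω) (V ω), W ω⟫ ∂P = 0 := by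
  have hmeas := hG.measurable_error hf
  have hmem := hG.memLp_error_sample hf hVY hS hν hXVW.fst
    (hind.comp measurable_fst measurable_id)
  have hint : Integrable (fun ω => ⟪G (X ω) (V ω) (S ω) - grad f (X ω) (V ω), W ω⟫) P :=
    ((hmem.integrable one_le_two).norm.mul_const C).mono'
      (hmem.1.inner hXVW.snd.aestronglyMeasurable) (.of_forall fun ω =>
        (norm_inner_le_norm _ _).trans (mul_le_mul_of_nonneg_left (hW ω) (norm_nonneg _)))
  rw [integral_comp_prodMk_of_indepFun hXVW hS hind
    (F := fun q => ⟪G q.1.1.1 q.1.1.2 q.2 - grad f q.1.1.1 q.1.1.2, q.1.2⟫)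
    ((hmeas.comp (measurable_fst.fst.prodMk measurable_snd)).inner
      measurable_fst.snd).stronglyMeasurable hint, hν]
  simp_rw [hG.integral_inner_error _ (hVY _), integral_zero]

end IsStochasticGradient

/-! ### The two algorithms as noisy runs -/

theorem isNoisyRun_ttgda {m n : ℕ} (f : Vec m → Vec n → ℝ) {Y : Set (Vec n)} (ηx ηy : ℝ)
    (x₀ : Vec m) {y₀ : Vec n} (hy₀ : y₀ ∈ Y) :
    IsNoisyRun f Y ηx ηy 0 x₀ y₀ (Measure.dirac ()) (Filtration.const ℕ inferInstance le_rfl)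
      (fun t _ => (ttgda f Y (fun _ => ηx) (fun _ => ηy) x₀ y₀ t).x)
      (fun t _ => (ttgda f Y (fun _ => ηx) (fun _ => ηy) x₀ y₀ t).y)
      (fun t _ => grad f (ttgda f Y (fun _ => ηx) (fun _ => ηy) x₀ y₀ t).x
        (ttgda f Y (fun _ => ηx) (fun _ => ηy) x₀ y₀ t).y) where
  start_mem := hy₀
  x_zero _ := rfl
  y_zero _ := rfl
  x_succ _ _ := rfl
  y_succ _ _ := rfl
  x_measurable _ := measurable_const
  y_measurable _ := measurable_const
  noise_memLp t := (memLp_const 0).ae_eq (.of_forall fun _ => (sub_self _).symm)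
  noise_variance t := by simp [noise]
  noise_orthogonal t W C _ _ := by simp [noise]

/-- The random state of TTSGDA with constant step sizes after `t` iterations. -/
def ttsgdaRun {m n M : ℕ} {Ξ Ω : Type*} (G : Vec m → Vec n → Ξ → VecPair m n)
    (Y : Set (Vec n)) (ηx ηy : ℝ) (x₀ : Vec m) (y₀ : Vec n) (ξ : ℕ → Fin M → Ω → Ξ) (t : ℕ)
    (ω : Ω) : State m n :=
  ttsgda G Y (fun _ => ηx) (fun _ => ηy) x₀ y₀ (fun s i => ξ s i ω) t

theorem SG_one {m n : ℕ} {Ξ : Type*} (G : Vec m → Vec n → Ξ → VecPair m n) (s : Fin 1 → Ξ)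
    (x : Vec m) (y : Vec n) : SG G s x y = G x y (s 0) := by
  simp [SG]

section Ttsgda

variable {m n : ℕ} {Ξ Ω : Type*} {G : Vec m → Vec n → Ξ → VecPair m n} {Y : Set (Vec n)}
  {ηx ηy : ℝ} {x₀ : Vec m} {y₀ : Vec n} {ξ : ℕ → Fin 1 → Ω → Ξ}

theorem ttsgdaRun_x_succ (t : ℕ) (ω : Ω) :
    (ttsgdaRun G Y ηx ηy x₀ y₀ ξ (t + 1) ω).x = (ttsgdaRun G Y ηx ηy x₀ y₀ ξ t ω).x -
      ηx • (G (ttsgdaRun G Y ηx ηy x₀ y₀ ξ t ω).x (ttsgdaRun G Y ηx ηy x₀ y₀ ξ t ω).y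
        (ξ t 0 ω)).fst := by
  rw [← SG_one G fun i => ξ t i ω]
  rfl

theorem ttsgdaRun_y_succ (t : ℕ) (ω : Ω) :
    (ttsgdaRun G Y ηx ηy x₀ y₀ ξ (t + 1) ω).y = proj Y ((ttsgdaRun G Y ηx ηy x₀ y₀ ξ t ω).y +
      ηy • (G (ttsgdaRun G Y ηx ηy x₀ y₀ ξ t ω).x (ttsgdaRun G Y ηx ηy x₀ y₀ ξ t ω).y
        (ξ t 0 ω)).snd) := by
  rw [← SG_one G fun i => ξ t i ω]
  rfl

variable {f : Vec m → Vec n → ℝ} {ℓ L D : ℝ} (h : SmoothNonconvexConcave f Y ℓ L D)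
include h

theorem ttsgdaRun_y_mem (hy₀ : y₀ ∈ Y) (t : ℕ) (ω : Ω) :
    (ttsgdaRun G Y ηx ηy x₀ y₀ ξ t ω).y ∈ Y := by
  cases t with
  | zero => exact hy₀
  | succ t => exact h.proj_mem _

variable [MeasurableSpace Ξ] {mΩ : MeasurableSpace Ω}

theorem measurable_ttsgdaRun (hG : Measurable fun p : Vec m × Vec n × Ξ => G p.1 p.2.1 p.2.2)
    (hξ : ∀ t i, Measurable (ξ t i)) (t : ℕ) :
    Measurable[sampleFiltration hξ t] fun ω =>
      ((ttsgdaRun G Y ηx ηy x₀ y₀ ξ t ω).x, (ttsgdaRun G Y ηx ηy x₀ y₀ ξ t ω).y) := by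
  induction t with
  | zero => exact measurable_const (a := (x₀, y₀))
  | succ t ih =>
    have hpast := ih.mono ((sampleFiltration hξ).mono (Nat.le_succ t)) le_rfl
    have hsample := measurable_sampleFiltration hξ (Nat.lt_succ_self t) 0
    have hestimate := hG.comp (hpast.fst.prodMk (hpast.snd.prodMk hsample))
    simp_rw [ttsgdaRun_x_succ, ttsgdaRun_y_succ]
    refine Measurable.prodMk ?_ ?_
    · exact hpast.fst.sub
        (((WithLp.continuous_fst 2 _ _).measurable.comp hestimate).const_smul ηx)
    · exact (continuous_proj h.closed h.nonempty h.convex).measurable.comp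
        (hpast.snd.add (((WithLp.continuous_snd 2 _ _).measurable.comp hestimate).const_smul ηy))

theorem isNoisyRun_ttsgda {P : Measure Ω} [IsProbabilityMeasure P] {ν : Measure Ξ} {σ : ℝ}
    (hG : IsStochasticGradient f Y G ν σ) (hξ : IsSampling P ν ξ) (hy₀ : y₀ ∈ Y) :
    IsNoisyRun f Y ηx ηy σ x₀ y₀ P (sampleFiltration hξ.measurable)
      (fun t ω => (ttsgdaRun G Y ηx ηy x₀ y₀ ξ t ω).x)
      (fun t ω => (ttsgdaRun G Y ηx ηy x₀ y₀ ξ t ω).y)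
      (fun t ω => G (ttsgdaRun G Y ηx ηy x₀ y₀ ξ t ω).x (ttsgdaRun G Y ηx ηy x₀ y₀ ξ t ω).y
        (ξ t 0 ω)) := by
  let z : ℕ → Ω → Vec m × Vec n := fun t ω =>
    ((ttsgdaRun G Y ηx ηy x₀ y₀ ξ t ω).x, (ttsgdaRun G Y ηx ηy x₀ y₀ ξ t ω).y)
  have hz (t : ℕ) : Measurable[sampleFiltration hξ.measurable t] (z t) :=
    measurable_ttsgdaRun h hG.measurable hξ.measurable t
  have hle := (sampleFiltration hξ.measurable).le
  have hzY (t : ℕ) (ω : Ω) : (z t ω).2 ∈ Y := ttsgdaRun_y_mem h hy₀ t ω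
  refine ⟨hy₀, fun _ => rfl, fun _ => rfl, ttsgdaRun_x_succ, ttsgdaRun_y_succ,
    fun t => (hz t).fst, fun t => (hz t).snd, fun t => ?_, fun t => ?_, fun t W C hW hC => ?_⟩
  · exact hG.memLp_error_sample h.smooth (hzY t) (hξ.measurable t 0) (hξ.law t 0)
      ((hz t).mono (hle t) le_rfl) (hξ.indepFun (hz t) 0)
  · exact hG.integral_norm_sq_error_sample_le h.smooth (hzY t) (hξ.measurable t 0)
      (hξ.law t 0) ((hz t).mono (hle t) le_rfl) (hξ.indepFun (hz t) 0)
  · have hpair := (hz t).prodMk hW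
    exact hG.integral_inner_error_sample h.smooth (hzY t) (hξ.measurable t 0) (hξ.law t 0)
      (hpair.mono (hle t) le_rfl) (hξ.indepFun hpair 0) hC

end Ttsgda

/-! ### The random output index -/

section UniformIndex

instance (T : ℕ) : IsProbabilityMeasure (uniformIndex T) :=
  PMF.toMeasure.isProbabilityMeasure _

theorem integral_uniformIndex (T : ℕ) (u : Fin (T + 1) → ℝ) :
    ∫ k, u k ∂uniformIndex T = (∑ k, u k) / ((T + 1 : ℕ) : ℝ) := by
  rw [uniformIndex, PMF.integral_eq_sum, Finset.sum_div]
  refine Finset.sum_congr rfl fun k _ => ?_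
  rw [PMF.uniformOfFintype_apply, Fintype.card_fin, smul_eq_mul, ENNReal.toReal_inv,
    ENNReal.toReal_natCast, inv_mul_eq_div]

variable {T : ℕ}

theorem integral_uniformIndex_le {u : ℕ → ℝ} {c : ℝ}
    (hu : ∑ t ∈ Finset.range (T + 1), u t ≤ ((T + 1 : ℕ) : ℝ) * c) :
    ∫ k : Fin (T + 1), u k ∂uniformIndex T ≤ c := by
  rwa [integral_uniformIndex T fun k => u k, Fin.sum_univ_eq_sum_range u (T + 1),
    div_le_iff₀' (by positivity)]

theorem exists_le_of_sum_range_succ_le {u : ℕ → ℝ} {c : ℝ}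
    (hu : ∑ t ∈ Finset.range (T + 1), u t ≤ ((T + 1 : ℕ) : ℝ) * c) : ∃ t ≤ T, u t ≤ c := by
  obtain ⟨t, ht, hut⟩ := Finset.exists_le_of_sum_le (g := fun _ => c)
    Finset.nonempty_range_add_one (by simpa using hu)
  exact ⟨t, Nat.lt_succ_iff.1 (Finset.mem_range.1 ht), hut⟩

theorem integrable_prod_uniformIndex {Ω : Type*} [MeasurableSpace Ω] {P : Measure Ω}
    [IsFiniteMeasure P] {u : ℕ → Ω → ℝ} {C : ℝ} (hu : ∀ t, Measurable (u t))
    (hC : ∀ t ω, ‖u t ω‖ ≤ C) :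
    Integrable (fun q : Ω × Fin (T + 1) => u q.2 q.1) (P.prod (uniformIndex T)) :=
  have hmeas : Measurable fun q : Ω × Fin (T + 1) => u q.2 q.1 :=
    measurable_from_prod_countable_left fun k : Fin (T + 1) => hu k
  (integrable_const C).mono' hmeas.aestronglyMeasurable (.of_forall fun q => hC q.2 q.1)

end UniformIndex

/-! ### Admissibility of the step sizes -/

section StepSizeChoice

variable {ℓ L D σ ε : ℝ}

theorem one_div_min_le {a b c : ℝ} (ha : 1 / a ≤ c) (hb : 1 / b ≤ c) : 1 / min a b ≤ c := by
  rcases min_choice a b with h | h <;> rwa [h]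

theorem one_div_first_term_le {S κ : ℝ} (hℓ : 0 < ℓ) (hS : 0 < S) (hε : 0 < ε) (hκ : 1 ≤ κ) :
    1 / (ε ^ 2 / (80 * ℓ * S)) ≤ 131072 * (ℓ * S / ε ^ 2) * κ := by
  calc 1 / (ε ^ 2 / (80 * ℓ * S)) = 80 * (ℓ * S / ε ^ 2) * 1 := by field_simp
    _ ≤ 131072 * (ℓ * S / ε ^ 2) * κ := by gcongr; norm_num

theorem one_div_second_term_le {S κ c : ℝ} (hℓ : 0 < ℓ) (hS : 0 < S) (hD : 0 < D) (hε : 0 < ε)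
    (hc : 0 < c) (hc' : c ≤ 131072) (hκ : ℓ ^ 2 * D ^ 2 / ε ^ 2 ≤ κ) :
    1 / (ε ^ 4 / (c * ℓ ^ 3 * S * D ^ 2)) ≤ 131072 * (ℓ * S / ε ^ 2) * κ := by
  calc 1 / (ε ^ 4 / (c * ℓ ^ 3 * S * D ^ 2)) =
        c * (ℓ * S / ε ^ 2) * (ℓ ^ 2 * D ^ 2 / ε ^ 2) := by field_simp
    _ ≤ 131072 * (ℓ * S / ε ^ 2) * κ := by gcongr

theorem one_div_third_term_le {S κ : ℝ} (hℓ : 0 < ℓ) (hS : 0 < S) (hD : 0 < D) (hε : 0 < ε)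
    (hσ : σ ≠ 0) (hκ : ℓ ^ 2 * D ^ 2 * σ ^ 2 / ε ^ 4 ≤ κ) :
    1 / (ε ^ 6 / (131072 * ℓ ^ 3 * S * D ^ 2 * σ ^ 2)) ≤ 131072 * (ℓ * S / ε ^ 2) * κ := by
  calc 1 / (ε ^ 6 / (131072 * ℓ ^ 3 * S * D ^ 2 * σ ^ 2)) =
        131072 * (ℓ * S / ε ^ 2) * (ℓ ^ 2 * D ^ 2 * σ ^ 2 / ε ^ 4) := by field_simp
    _ ≤ 131072 * (ℓ * S / ε ^ 2) * κ := by gcongr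

theorem admissibleStepSizes_etaX (hℓ : 0 < ℓ) (hL : 0 < L) (hD : 0 < D) (hε : 0 < ε) :
    AdmissibleStepSizes ℓ L D 0 ε (max 1 (ℓ ^ 2 * D ^ 2 / ε ^ 2)) (etaX ℓ L D ε) (1 / ℓ) := by
  have hdrift : etaX ℓ L D ε ≤ ε ^ 2 / (80 * ℓ * L ^ 2) := min_le_left _ _
  have hblock : etaX ℓ L D ε ≤ ε ^ 4 / (4096 * ℓ ^ 3 * L ^ 2 * D ^ 2) := min_le_right _ _
  rw [le_div_iff₀ (by positivity)] at hdrift hblock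
  have hLσ : L ^ 2 + 0 ^ 2 = L ^ 2 := by ring
  refine ⟨lt_min (by positivity) (by positivity), by positivity,
    Or.inr ⟨(one_div_mul_cancel hℓ.ne').le, rfl⟩, ?_, ?_, ?_, le_max_left _ _, ?_, ?_⟩
  · rw [hLσ]
    linarith
  · rw [hLσ, one_div_mul_eq_div, div_div, le_div_iff₀ (by positivity)]
    linarith
  · rw [zero_pow two_ne_zero, mul_zero, mul_zero]
    positivity
  · rw [hLσ]
    exact one_div_min_le (one_div_first_term_le hℓ (by positivity) hε (le_max_left _ _))
      (one_div_second_term_le hℓ (by positivity) hD hε (by norm_num) (by norm_num)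
        (le_max_right _ _))
  · calc ℓ * D ^ 2 / (1 / ℓ * ε ^ 2) = 1 * (ℓ ^ 2 * D ^ 2 / ε ^ 2) := by field_simp
      _ ≤ 32 * max 1 (ℓ ^ 2 * D ^ 2 / ε ^ 2) := by
        gcongr
        · norm_num
        · exact le_max_right _ _

theorem etaYStoch_pos (hℓ : 0 < ℓ) (hε : 0 < ε) : 0 < etaYStoch ℓ σ ε := by
  unfold etaYStoch
  split_ifs with hσ
  · positivity
  · exact lt_min (by positivity) (by positivity)

theorem etaYStoch_le : etaYStoch ℓ σ ε ≤ 1 / (2 * ℓ) := by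
  unfold etaYStoch
  split_ifs with hσ
  · exact le_rfl
  · exact min_le_left _ _

theorem etaYStoch_le_of_ne_zero (hσ : σ ≠ 0) : etaYStoch ℓ σ ε ≤ ε ^ 2 / (32 * ℓ * σ ^ 2) := by
  rw [etaYStoch, if_neg hσ]
  exact min_le_right _ _

theorem etaYStoch_eq_or : etaYStoch ℓ σ ε = 1 / (2 * ℓ) ∨
    σ ≠ 0 ∧ etaYStoch ℓ σ ε = ε ^ 2 / (32 * ℓ * σ ^ 2) := by
  unfold etaYStoch
  split_ifs with hσ
  · exact Or.inl rfl
  · exact (min_choice _ _).imp_right fun hmin => ⟨hσ, hmin⟩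

theorem etaXStoch_pos (hℓ : 0 < ℓ) (hL : 0 < L) (hD : 0 < D) (hε : 0 < ε) :
    0 < etaXStoch ℓ L D σ ε := by
  unfold etaXStoch
  split_ifs with hσ
  · exact lt_min (by positivity) (by positivity)
  · exact lt_min (by positivity) (lt_min (by positivity) (by positivity))

theorem etaXStoch_le_first :
    etaXStoch ℓ L D σ ε ≤ ε ^ 2 / (80 * ℓ * (L ^ 2 + σ ^ 2)) := by
  unfold etaXStoch
  split_ifs with hσ <;> exact min_le_left _ _

theorem etaXStoch_le_second :
    etaXStoch ℓ L D σ ε ≤ ε ^ 4 / (8192 * ℓ ^ 3 * (L ^ 2 + σ ^ 2) * D ^ 2) := by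
  unfold etaXStoch
  split_ifs with hσ
  · exact min_le_right _ _
  · exact (min_le_right _ _).trans (min_le_left _ _)

theorem etaXStoch_le_third (hσ : σ ≠ 0) : etaXStoch ℓ L D σ ε ≤
    ε ^ 6 / (131072 * ℓ ^ 3 * (L ^ 2 + σ ^ 2) * D ^ 2 * σ ^ 2) := by
  rw [etaXStoch, if_neg hσ]
  exact (min_le_right _ _).trans (min_le_right _ _)

theorem one_div_etaXStoch_le (hℓ : 0 < ℓ) (hL : 0 < L) (hD : 0 < D) (hε : 0 < ε) :
    1 / etaXStoch ℓ L D σ ε ≤ 131072 * (ℓ * (L ^ 2 + σ ^ 2) / ε ^ 2) *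
      max 1 (max (ℓ ^ 2 * D ^ 2 / ε ^ 2) (ℓ ^ 2 * D ^ 2 * σ ^ 2 / ε ^ 4)) := by
  have hS : 0 < L ^ 2 + σ ^ 2 := by positivity
  have hfirst := one_div_first_term_le hℓ hS hε (le_max_left 1
    (max (ℓ ^ 2 * D ^ 2 / ε ^ 2) (ℓ ^ 2 * D ^ 2 * σ ^ 2 / ε ^ 4)))
  have hsecond := one_div_second_term_le (c := 8192) hℓ hS hD hε (by norm_num) (by norm_num)
    ((le_max_left _ (ℓ ^ 2 * D ^ 2 * σ ^ 2 / ε ^ 4)).trans (le_max_right 1 _))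
  unfold etaXStoch
  split_ifs with hσ
  · exact one_div_min_le hfirst hsecond
  · exact one_div_min_le hfirst (one_div_min_le hsecond
      (one_div_third_term_le hℓ hS hD hε hσ ((le_max_right _ _).trans (le_max_right _ _))))

theorem etaXStoch_block_drift_le (hℓ : 0 < ℓ) (hL : 0 < L) (hD : 0 < D) (hε : 0 < ε) :
    ℓ ^ 2 * D ^ 2 * (etaXStoch ℓ L D σ ε * (L ^ 2 + σ ^ 2)) ≤
      etaYStoch ℓ σ ε * ε ^ 4 / 4096 := by
  rcases etaYStoch_eq_or (ℓ := ℓ) (σ := σ) (ε := ε) with hηy | ⟨hσ, hηy⟩ <;> rw [hηy]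
  · calc ℓ ^ 2 * D ^ 2 * (etaXStoch ℓ L D σ ε * (L ^ 2 + σ ^ 2))
        ≤ ℓ ^ 2 * D ^ 2 * (ε ^ 4 / (8192 * ℓ ^ 3 * (L ^ 2 + σ ^ 2) * D ^ 2) *
          (L ^ 2 + σ ^ 2)) := by gcongr; exact etaXStoch_le_second
      _ = 1 / (2 * ℓ) * ε ^ 4 / 4096 := by field_simp; norm_num
  · calc ℓ ^ 2 * D ^ 2 * (etaXStoch ℓ L D σ ε * (L ^ 2 + σ ^ 2))
        ≤ ℓ ^ 2 * D ^ 2 * (ε ^ 6 / (131072 * ℓ ^ 3 * (L ^ 2 + σ ^ 2) * D ^ 2 * σ ^ 2) *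
          (L ^ 2 + σ ^ 2)) := by gcongr; exact etaXStoch_le_third hσ
      _ = ε ^ 2 / (32 * ℓ * σ ^ 2) * ε ^ 4 / 4096 := by field_simp; norm_num

theorem etaYStoch_noise_le (hℓ : 0 < ℓ) : ℓ * (etaYStoch ℓ σ ε * σ ^ 2) ≤ ε ^ 2 / 32 := by
  rcases eq_or_ne σ 0 with rfl | hσ
  · rw [zero_pow two_ne_zero, mul_zero, mul_zero]
    positivity
  · calc ℓ * (etaYStoch ℓ σ ε * σ ^ 2) ≤ ℓ * (ε ^ 2 / (32 * ℓ * σ ^ 2) * σ ^ 2) := by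
          gcongr
          exact etaYStoch_le_of_ne_zero hσ
      _ = ε ^ 2 / 32 := by field_simp

theorem div_etaYStoch_le (hℓ : 0 < ℓ) (hε : 0 < ε) :
    ℓ * D ^ 2 / (etaYStoch ℓ σ ε * ε ^ 2) ≤
      32 * max 1 (max (ℓ ^ 2 * D ^ 2 / ε ^ 2) (ℓ ^ 2 * D ^ 2 * σ ^ 2 / ε ^ 4)) := by
  rcases etaYStoch_eq_or (ℓ := ℓ) (σ := σ) (ε := ε) with hηy | ⟨hσ, hηy⟩ <;> rw [hηy]
  · calc ℓ * D ^ 2 / (1 / (2 * ℓ) * ε ^ 2) = 2 * (ℓ ^ 2 * D ^ 2 / ε ^ 2) := by field_simp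
      _ ≤ _ := by
        gcongr
        · norm_num
        · exact (le_max_left _ _).trans (le_max_right _ _)
  · calc ℓ * D ^ 2 / (ε ^ 2 / (32 * ℓ * σ ^ 2) * ε ^ 2) =
          32 * (ℓ ^ 2 * D ^ 2 * σ ^ 2 / ε ^ 4) := by field_simp
      _ ≤ _ := by
        gcongr
        exact (le_max_right _ _).trans (le_max_right _ _)

theorem admissibleStepSizes_etaXStoch (hℓ : 0 < ℓ) (hL : 0 < L) (hD : 0 < D) (hε : 0 < ε) :
    AdmissibleStepSizes ℓ L D σ ε
      (max 1 (max (ℓ ^ 2 * D ^ 2 / ε ^ 2) (ℓ ^ 2 * D ^ 2 * σ ^ 2 / ε ^ 4)))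
      (etaXStoch ℓ L D σ ε) (etaYStoch ℓ σ ε) where
  x_pos := etaXStoch_pos hℓ hL hD hε
  y_pos := etaYStoch_pos hℓ hε
  y_le := by
    have hle := etaYStoch_le (ℓ := ℓ) (σ := σ) (ε := ε)
    rw [le_div_iff₀ (by positivity)] at hle
    left
    linarith
  drift_le := by
    have hle := etaXStoch_le_first (ℓ := ℓ) (L := L) (D := D) (σ := σ) (ε := ε)
    rw [le_div_iff₀ (by positivity)] at hle
    linarith
  block_drift_le := etaXStoch_block_drift_le hℓ hL hD hε
  noise_le := etaYStoch_noise_le hℓ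
  one_le := le_max_left _ _
  inv_x_le := one_div_etaXStoch_le hℓ hL hD hε
  inv_y_le := div_etaYStoch_le hℓ hε

end StepSizeChoice

/-! ### Iteration complexity -/

theorem ttgda_evals {m n : ℕ} (f : Vec m → Vec n → ℝ) (Y : Set (Vec n)) (ηx ηy : ℕ → ℝ)
    (x₀ : Vec m) (y₀ : Vec n) (t : ℕ) : (ttgda f Y ηx ηy x₀ y₀ t).evals = t := by
  induction t with
  | zero => rfl
  | succ t ih => simp [ttgda, State.step, ih]

theorem ttsgda_evals {m n M : ℕ} {Ξ : Type*} (G : Vec m → Vec n → Ξ → VecPair m n)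
    (Y : Set (Vec n)) (ηx ηy : ℕ → ℝ) (x₀ : Vec m) (y₀ : Vec n) (ξ : ℕ → Fin M → Ξ) (t : ℕ) :
    (ttsgda G Y ηx ηy x₀ y₀ ξ t).evals = t * M := by
  induction t with
  | zero => exact (Nat.zero_mul M).symm
  | succ t ih => simp [ttsgda, State.step, ih, add_mul]

section Complexity

variable {m n : ℕ} {f : Vec m → Vec n → ℝ} {Y : Set (Vec n)} {ℓ L D ε : ℝ} {x₀ : Vec m}
  {y₀ : Vec n} (h : SmoothNonconvexConcave f Y ℓ L D)
include h

theorem SmoothNonconvexConcave.complexityBound_nonneg (hbdd : BddBelow (Set.range (maxFun f Y)))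
    (hy₀ : y₀ ∈ Y) {S κ : ℝ} (hS : 0 ≤ S) (hκ : 0 ≤ κ) :
    0 ≤ (ℓ * S * (maxFun f Y x₀ - ⨅ x, maxFun f Y x) / ε ^ 4 +
      ℓ * (maxFun f Y x₀ - f x₀ y₀) / ε ^ 2) * κ := by
  have hℓ := h.ell_pos
  have hΦ := sub_nonneg.2 (ciInf_le hbdd x₀)
  have hgap := sub_nonneg.2 (h.le_maxFun x₀ hy₀)
  positivity

variable (hε : 0 < ε) (hy₀ : y₀ ∈ Y) (hbdd : BddBelow (Set.range (maxFun f Y)))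
include hε hy₀ hbdd

theorem ttgda_complexity :
    ∃ N : ℕ,
      ((ttgda f Y (fun _ => etaX ℓ L D ε) (fun _ => 1 / ℓ) x₀ y₀ N).evals : ℝ) ≤
        1048576 * boundDet ℓ L D (maxFun f Y x₀ - ⨅ x, maxFun f Y x)
          (maxFun f Y x₀ - f x₀ y₀) ε ∧
      ∀ T : ℕ, N ≤ T →
        IsStationaryInMeanSquare (uniformIndex T) (maxFun f Y) ℓ ε (fun k : Fin (T + 1) =>
          (ttgda f Y (fun _ => etaX ℓ L D ε) (fun _ => 1 / ℓ) x₀ y₀ k).x) ∧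
        ∃ t ≤ T, IsStationary (maxFun f Y) ℓ ε
          (ttgda f Y (fun _ => etaX ℓ L D ε) (fun _ => 1 / ℓ) x₀ y₀ t).x := by
  obtain ⟨p, hp⟩ := h.exists_proxMap hbdd
  have hdiff := differentiable_moreauEnvelope hp h.ell_pos
  refine ⟨⌊1048576 * boundDet ℓ L D (maxFun f Y x₀ - ⨅ x, maxFun f Y x)
    (maxFun f Y x₀ - f x₀ y₀) ε⌋₊, ?_, fun T hT => ?_⟩
  · rw [ttgda_evals]
    exact Nat.floor_le (mul_nonneg (by norm_num)
      (h.complexityBound_nonneg hbdd hy₀ (sq_nonneg L) (by positivity)))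
  have hrate := (isNoisyRun_ttgda f (etaX ℓ L D ε) (1 / ℓ) x₀ hy₀).sum_meanSqGrad_le_mul_sq
    (T := T + 1) h hp hbdd hε (admissibleStepSizes_etaX h.ell_pos h.L_pos h.D_pos hε) (by
      rw [zero_pow two_ne_zero, add_zero]
      exact (Nat.lt_of_floor_lt (Nat.lt_succ_of_le hT)).le)
  simp only [meanSqGrad, integral_const, probReal_univ, one_smul] at hrate
  refine ⟨⟨h.isWeaklyConvex, hdiff, .of_finite, integral_uniformIndex_le hrate⟩, ?_⟩
  obtain ⟨t, htT, hle⟩ := exists_le_of_sum_range_succ_le hrate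
  exact ⟨t, htT, h.isWeaklyConvex, hdiff _, le_of_sq_le_sq hle hε.le⟩

theorem ttsgda_complexity {Ξ Ω : Type*} [MeasurableSpace Ξ] [MeasurableSpace Ω]
    {G : Vec m → Vec n → Ξ → VecPair m n} {ν : Measure Ξ} {σ : ℝ}
    (hG : IsStochasticGradient f Y G ν σ) {P : Measure Ω} [IsProbabilityMeasure P]
    {ξ : ℕ → Fin 1 → Ω → Ξ} (hξ : IsSampling P ν ξ) :
    ∃ N : ℕ,
      (∀ ω, ((ttsgdaRun G Y (etaXStoch ℓ L D σ ε) (etaYStoch ℓ σ ε) x₀ y₀ ξ N ω).evals : ℝ) ≤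
        1048576 * boundStoch ℓ L D σ (maxFun f Y x₀ - ⨅ x, maxFun f Y x)
          (maxFun f Y x₀ - f x₀ y₀) ε) ∧
      ∀ T : ℕ, N ≤ T →
        IsStationaryInMeanSquare (P.prod (uniformIndex T)) (maxFun f Y) ℓ ε
          (fun q : Ω × Fin (T + 1) =>
            (ttsgdaRun G Y (etaXStoch ℓ L D σ ε) (etaYStoch ℓ σ ε) x₀ y₀ ξ q.2 q.1).x) := by
  obtain ⟨p, hp⟩ := h.exists_proxMap hbdd
  have r := isNoisyRun_ttsgda (ηx := etaXStoch ℓ L D σ ε) (ηy := etaYStoch ℓ σ ε)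
    (x₀ := x₀) h hG hξ hy₀
  refine ⟨⌊1048576 * boundStoch ℓ L D σ (maxFun f Y x₀ - ⨅ x, maxFun f Y x)
    (maxFun f Y x₀ - f x₀ y₀) ε⌋₊, fun ω => ?_, fun T hT => ?_⟩
  · rw [ttsgdaRun, ttsgda_evals, mul_one]
    exact Nat.floor_le (mul_nonneg (by norm_num)
      (h.complexityBound_nonneg hbdd hy₀ (by positivity) (by positivity)))
  have hrate := r.sum_meanSqGrad_le_mul_sq (T := T + 1) h hp hbdd hε
    (admissibleStepSizes_etaXStoch h.ell_pos h.L_pos h.D_pos hε)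
    (Nat.lt_of_floor_lt (Nat.lt_succ_of_le hT)).le
  have hint := integrable_prod_uniformIndex (P := P) (T := T) (C := (2 * L) ^ 2)
    (fun t => ((h.continuous_norm_gradient_envelope hp).measurable.comp
      (r.measurable_x t)).pow_const 2) fun t ω => by
    rw [Real.norm_of_nonneg (sq_nonneg _)]
    exact pow_le_pow_left₀ (norm_nonneg _) (h.norm_gradient_envelope_le hp _) 2
  refine ⟨h.isWeaklyConvex, differentiable_moreauEnvelope hp h.ell_pos, hint, ?_⟩
  exact (integral_prod_symm _ hint).trans_le (integral_uniformIndex_le hrate)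

end Complexity

end TwoTimescale

end

open TwoTimescale in
/-- The constant `C` is absolute: it is chosen before all problem data. In both parts a run whose
number of (stochastic) gradient evaluations is at most `C` times the bound, and every longer run,
returns an `ε`-stationary point of `Φ`, where the returned point is drawn uniformly from
`x_0, …, x_T`. -/
theorem mainTheorem3 :
    ∃ C : ℝ, 0 < C ∧
      ∀ (m n : ℕ) (f : Vec m → Vec n → ℝ) (Y : Set (Vec n)) (ℓ L D ε : ℝ)
        (x₀ : Vec m) (y₀ : Vec n),
        SmoothNonconvexConcave f Y ℓ L D → 0 < ε → y₀ ∈ Y →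
        BddBelow (Set.range (maxFun f Y)) →
        ∀ ΔΦ Δ₀ : ℝ, ΔΦ = maxFun f Y x₀ - (⨅ x, maxFun f Y x) →
          Δ₀ = maxFun f Y x₀ - f x₀ y₀ →
        -- TTGDA
        (∃ N : ℕ,
          let run := ttgda f Y (fun _ => etaX ℓ L D ε) (fun _ => 1 / ℓ) x₀ y₀
          ((run N).evals : ℝ) ≤ C * boundDet ℓ L D ΔΦ Δ₀ ε ∧
          ∀ T : ℕ, N ≤ T →
            IsStationaryInMeanSquare (uniformIndex T) (maxFun f Y) ℓ ε
              (fun k : Fin (T + 1) => (run k).x) ∧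
            ∃ t ≤ T, IsStationary (maxFun f Y) ℓ ε (run t).x) ∧
        -- TTSGDA with `M = 1`
        (∀ (Ξ : Type*) [MeasurableSpace Ξ] (G : Vec m → Vec n → Ξ → VecPair m n)
          (ν : Measure Ξ) (σ : ℝ), IsStochasticGradient f Y G ν σ →
          ∀ (Ω : Type*) [MeasurableSpace Ω] (P : Measure Ω) [IsProbabilityMeasure P]
            (ξ : ℕ → Fin 1 → Ω → Ξ), IsSampling P ν ξ →
          ∃ N : ℕ,
            let run := fun ω : Ω => ttsgda G Y (fun _ => etaXStoch ℓ L D σ ε)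
              (fun _ => etaYStoch ℓ σ ε) x₀ y₀ (fun t i => ξ t i ω)
            (∀ ω, ((run ω N).evals : ℝ) ≤ C * boundStoch ℓ L D σ ΔΦ Δ₀ ε) ∧
            ∀ T : ℕ, N ≤ T →
              IsStationaryInMeanSquare (P.prod (uniformIndex T)) (maxFun f Y) ℓ ε
                (fun p : Ω × Fin (T + 1) => (run p.1 p.2).x)) := by
  refine ⟨1048576, by norm_num, ?_⟩
  rintro m n f Y ℓ L D ε x₀ y₀ h hε hy₀ hbdd _ _ rfl rfl
  exact ⟨ttgda_complexity h hε hy₀ hbdd, fun Ξ _ G ν σ hG Ω _ P _ ξ hξ =>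
    ttsgda_complexity h hε hy₀ hbdd hG hξ⟩
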